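/- Theorem 3.4. Let $\Pi$ be a finite simple graph and let $W$ be the simply-laced Coxeter group of $\Pi$: it is generated by $s_i$ ($i\in\Pi$) with relations $s_i^2=e$, $s_is_j=s_js_i$ for distinct non-adjacent $i,j$, and $s_is_js_i=s_js_is_j$ for adjacent $i,j$. Words are written in the signed alphabet $\{+1,-1\}\times\Pi$, whose letters are written $\pm i$, with $\varepsilon(\pm i)=\pm1$ and $|\pm i|=i$. The letter $-i$ stands for the element $(s_i,e)$ of $W\times W$ and $+i$ stands for $(e,s_i)$. A reduced word for $(u,v)\in W\times W$ is a word $\mathbf i=(i_1,\dots,i_m)$ whose product is $(u,v)$ and whose length $m$ is smallest possible; then $m=\ell(u)+\ell(v)$. For such a word $\mathbf i$ and $l\in[1,m]$, let $l^-$ be the largest $k<l$ with $|i_k|=|i_l|$, or $l^-=0$ if there is none, and let $B(\mathbf i)=\{l\in[1,m]: l^->0\}$. Let $\Sigma(\mathbf i)$ be the directed graph with vertex set $[1,m]$ in which $\{k,l\}$ with $k<l$ is an edge if and only if one of the following holds: (i) $k=l^-$; (ii) $k^-<l^-<k$, $|i_k|$ and $|i_l|$ are adjacent in $\Pi$, and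 $\varepsilon(i_{l^-})=\varepsilon(i_k)$; (iii) $l^-<k^-<k$, $|i_k|$ and $|i_l|$ are adjacent in $\Pi$, and $\varepsilon(i_{k^-})=-\varepsilon(i_k)$. An edge $\{k,l\}$ ($k<l$) of type (i) is directed from $k$ to $l$ if $\varepsilon(i_k)=+1$ and from $l$ to $k$ otherwise; an edge of type (ii) or (iii) is directed from $k$ to $l$ if $\varepsilon(i_k)=-1$ and from $l$ to $k$ otherwise. Let $(e_k)$ be the standard basis of $\mathbb Z^m$ and $(\xi_k)$ the coordinate functions, and put $\Omega_{\mathbf i}=\sum_{(k\to l)\in\Sigma(\mathbf i)}\xi_k\wedge\xi_l$, where $(\xi_k\wedge\xi_l)(x,y)=\xi_k(x)\xi_l(y)-\xi_l(x)\xi_k(y)$. Let $\Gamma_{\mathbf i}\subset GL_m(\mathbb Z)$ be the subgroup generated by the symplectic transvections $\tau_{k,\mathbf i}(x)=x-\Omega_{\mathbf i}(x,e_k)\,e_k$ for $k\in B(\mathbf i)$. Then for any two reduced words $\mathbf i$ and $\mathbf i'$ for the same pair $(u,v)\in W\times W$, the groups $\Gamma_{\mathbf i}$ and $\Gamma_{\mathbf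 i'}$ are conjugate inside $GL_m(\mathbb Z)$: there is $g\in GL_m(\mathbb Z)$ with $\Gamma_{\mathbf i'}=g\,\Gamma_{\mathbf i}\,g^{-1}$. -/

import Mathlib

noncomputable section

open Classical in
/-- The simply-laced Coxeter matrix of a simple graph: `m i j = 3` if `i` and `j` are adjacent,
and `m i j = 2` if they are distinct and not adjacent. Hence a `CoxeterSystem (simplyLaced G) W`
says that `W` is the Coxeter group generated by the `s i` subject to `s i ^ 2 = 1`,
`s i * s j = s j * s i` (not adjacent) and `s i * s j * s i = s j * s i * s j` (adjacent). -/
def simplyLaced {P : Type*} (G : SimpleGraph P) : CoxeterMatrix P where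
  M := Matrix.of fun i j => if i = j then 1 else if G.Adj i j then 3 else 2
  isSymm := by
    ext i j
    simp only [Matrix.transpose_apply, Matrix.of_apply, eq_comm (a := j) (b := i),
      G.adj_comm j i]
  diagonal i := by simp
  off_diagonal i j h := by
    simp only [Matrix.of_apply, if_neg h]
    split_ifs <;> decide

/-! ### Reduced words for pairs

A letter is a pair `(ε, i)` with `ε = ± 1` and `i` a vertex of the graph; it stands for the
signed vertex `ε i`, with sign `ε` and absolute value `i`. -/

section Words

variable {P W : Type*} {M : CoxeterMatrix P} [Group W] (cs : CoxeterSystem M W)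

/-- The generator of `W × W` named by a letter: the letter `-i` gives `(s i, 1)` and the letter
`+i` gives `(1, s i)`. -/
def letterElement (a : ℤˣ × P) : W × W :=
  if a.1 = -1 then (cs.simple a.2, 1) else (1, cs.simple a.2)

/-- The word `i = (i 0, …, i (m - 1))` is a reduced word for `(u, v)` in `W × W`: the
product of its letters is `(u, v)`, and no shorter word has this product. -/
def IsReducedWord (u v : W) {m : ℕ} (i : Fin m → ℤˣ × P) : Prop :=
  ((List.ofFn i).map (letterElement cs)).prod = (u, v) ∧
    ∀ w : List (ℤˣ × P), (w.map (letterElement cs)).prod = (u, v) → m ≤ w.length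

end Words

/-! ### Groups generated by symplectic transvections -/

section Transvections

variable {S : Type*} [Fintype S] (D : Digraph S)

/-- The wedge product of two linear forms, as an alternating bilinear form:
`(f ∧ g) (x, y) = f x * g y - g x * f y`. -/
def wedge (f g : Module.Dual ℤ (S → ℤ)) : LinearMap.BilinForm ℤ (S → ℤ) :=
  LinearMap.BilinForm.linMulLin f g - LinearMap.BilinForm.linMulLin g f

open Classical in
/-- The skew-symmetric form `Ω = ∑ ξ k ∧ ξ l` on `ℤ^S`, summed over the directed edges `k → l`
of `D`, where `ξ k` is the `k`-th coordinate function. -/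
def omega : LinearMap.BilinForm ℤ (S → ℤ) :=
  ∑ e : S × S with D.Adj e.1 e.2, wedge (LinearMap.proj e.1) (LinearMap.proj e.2)

theorem omega_self (x : S → ℤ) : omega D x x = 0 := by
  simp [omega, wedge, LinearMap.sum_apply, mul_comm]

/-- The symplectic transvection `x ↦ x - Ω (x, e k) e k` as an element of `GL (ℤ^S)`, where `e k`
is the `k`-th standard basis vector. -/
def tau [DecidableEq S] (k : S) : LinearMap.GeneralLinearGroup ℤ (S → ℤ) :=
  LinearMap.GeneralLinearGroup.ofLinearEquiv
    { toFun := fun x => x - omega D x (Pi.single k 1) • Pi.single k 1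
      invFun := fun x => x + omega D x (Pi.single k 1) • Pi.single k 1
      map_add' := fun x y => by
        simp only [map_add, LinearMap.add_apply, add_smul]; abel
      map_smul' := fun r x => by
        simp only [map_smul, LinearMap.smul_apply, smul_eq_mul, mul_smul, RingHom.id_apply,
          smul_sub]
      left_inv := fun x => by
        simp only [map_sub, map_smul, LinearMap.sub_apply, LinearMap.smul_apply, omega_self,
          smul_zero, sub_zero, sub_add_cancel]
      right_inv := fun x => by
        simp only [map_add, map_smul, LinearMap.add_apply, LinearMap.smul_apply, omega_self,
          smul_zero, add_zero, add_sub_cancel_right] }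

/-- The subgroup of `GL (ℤ^S)` generated by the transvections `tau k` for `k ∈ B`. -/
def transvectionGroup [DecidableEq S] (B : Set S) : Subgroup (LinearMap.GeneralLinearGroup ℤ (S → ℤ)) :=
  Subgroup.closure (tau D '' B)

end Transvections

/-! ### The directed graph of a word

Positions in a word of length `m` are the elements of `Fin m`, so they are counted from `0`. -/

section WordGraph

variable {P : Type*} (G : SimpleGraph P) {m : ℕ} (i : Fin m → ℤˣ × P)

open Classical in
/-- The index `l⁻`: the largest `k < l` with `|i k| = |i l|`, and `⊥` (smaller than every
index) if there is none. -/
def prevIndex (l : Fin m) : WithBot (Fin m) :=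
  (Finset.univ.filter fun k : Fin m => k < l ∧ (i k).2 = (i l).2).max

/-- The bounded indices: those `l` for which `l⁻` is an actual index. -/
def boundedIndices : Set (Fin m) := {l | prevIndex i l ≠ ⊥}

/-- For `k < l`, the pair `{k, l}` is a horizontal edge: `k = l⁻`. -/
def IsHorizontal (k l : Fin m) : Prop := prevIndex i l = k

/-- For `k < l`, the pair `{k, l}` is an inclined edge: `|i k|` and `|i l|` are adjacent, and either
`k⁻ < l⁻ < k` and the entries at `l⁻` and `k` have the same sign, or
`l⁻ < k⁻ < k` and the entries at `k⁻` and `k` have opposite signs. -/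
def IsInclined (k l : Fin m) : Prop :=
  G.Adj (i k).2 (i l).2 ∧
    ((∃ p : Fin m, prevIndex i l = p ∧ prevIndex i k < p ∧ p < k ∧ (i p).1 = (i k).1) ∨
      (∃ p : Fin m, prevIndex i k = p ∧ prevIndex i l < p ∧ p < k ∧ (i p).1 = -(i k).1))

/-- The directed graph of a word. A horizontal (resp. inclined) edge `{k, l}` with `k < l` is
directed from `k` to `l` if the sign of `i k` is `+1` (resp. `-1`), and from `l` to `k`
otherwise. -/
def wordGraph : Digraph (Fin m) where
  Adj a b :=
    (a < b ∧ (IsHorizontal i a b ∧ (i a).1 = 1 ∨ IsInclined G i a b ∧ (i a).1 = -1)) ∨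
      (b < a ∧ (IsHorizontal i b a ∧ (i b).1 ≠ 1 ∨ IsInclined G i b a ∧ (i b).1 ≠ -1))

/-- The group attached to a word: the subgroup of `GL (ℤ^m)` generated by the symplectic
transvections of its directed graph at the bounded indices. -/
def wordGroup : Subgroup (LinearMap.GeneralLinearGroup ℤ (Fin m → ℤ)) :=
  transvectionGroup (wordGraph G i) (boundedIndices i)

end WordGraph

end

/-! ### The exchange property and reduced words of a simply-laced Coxeter group -/

noncomputable section Coxeter

variable {P W : Type*} {G : SimpleGraph P} [Group W] (cs : CoxeterSystem (simplyLaced G) W)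

/-! By Matsumoto's theorem in each factor, two reduced words of `(u, v)` are linked by three kinds
of moves: swaps of neighbouring letters of opposite signs, swaps at distinct non-adjacent vertices,
and braid moves within one sign. Having conjugate groups is an equivalence relation on words, so
each move may be treated alone (`IsMoveInvariant.of_isReducedWord`,
`conjugateWords_isMoveInvariant`).

For a swap at distinct vertices the conjugating map `g` only permutes two coordinates. For a swap of
`+i` and `-i`, or a braid move, `g` is such a permutation `σ` (possibly trivial) followed by a
reflection `x b ↦ f x - x b` of one coordinate, as in a cluster mutation: `f` sums the coordinates
of the neighbours of `b` on which the new form against `e b` has one of its two signs. Then `g`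
sends `e b` to `-e b`, and every other `e k` to `e (σ k)` or to `e (σ k) + e b`; in the last case
the new form of `e (σ k)` and `e b` is `±1`. Hence the transvection along `e (σ k) + e b` is a
conjugate of the one along `e (σ k)` by that along `e b` or its inverse, and the two generating sets
span the same subgroup (`transvection_add_mem_iff`, `transvectionGroup_eq_map_conj`).

It remains to see that `g` respects the forms. Comparing the edges of the two graphs directly would
be a long case analysis. Instead `wordForm` is a sum of local terms, one per letter, which agrees
with `2 * omega` whenever one argument is a bounded basis vector (`two_mul_omega`); no other values
enter the transvections. A prefix sees the rest of the word only through the first coordinate at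
each vertex (`wordForm_append_congr`), so invariance under a move is a polynomial identity in a few
coordinates (`wordForm_swap_letters`, `wordForm_swap_sign`, `wordForm_braid`). -/

theorem simplyLaced_of_adj {i j : P} (h : G.Adj i j) : simplyLaced G i j = 3 := by
  simp [simplyLaced, h, h.ne]

theorem simplyLaced_of_not_adj {i j : P} (hij : i ≠ j) (h : ¬ G.Adj i j) :
    simplyLaced G i j = 2 := by
  simp [simplyLaced, h, hij]

theorem simple_comm {i j : P} (hij : i ≠ j) (h : ¬ G.Adj i j) :
    cs.simple i * cs.simple j = cs.simple j * cs.simple i := by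
  have := cs.simple_mul_simple_pow i j
  rw [simplyLaced_of_not_adj hij h, pow_two] at this
  calc cs.simple i * cs.simple j = (cs.simple i * cs.simple j)⁻¹ := eq_inv_of_mul_eq_one_left this
    _ = _ := by simp

theorem simple_braid {i j : P} (h : G.Adj i j) :
    cs.simple i * cs.simple j * cs.simple i = cs.simple j * cs.simple i * cs.simple j := by
  have := cs.simple_mul_simple_pow i j
  rw [simplyLaced_of_adj h, pow_three] at this
  calc cs.simple i * cs.simple j * cs.simple i = (cs.simple j * cs.simple i * cs.simple j)⁻¹ :=
        eq_inv_of_mul_eq_one_left (by simpa [mul_assoc] using this)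
    _ = _ := by simp [mul_assoc]

/-- A family of involutions satisfying the commutation and braid relations lifts to the
simply-laced Coxeter group. -/
theorem isLiftable_simplyLaced {H : Type*} [Monoid H] (f : P → H) (hsq : ∀ i, f i * f i = 1)
    (hcomm : ∀ i j, i ≠ j → ¬ G.Adj i j → f i * f j = f j * f i)
    (hbraid : ∀ i j, G.Adj i j → f i * f j * f i = f j * f i * f j) :
    (simplyLaced G).IsLiftable f := by
  intro i j
  by_cases hij : i = j
  · subst hij; simp [hsq]
  by_cases h : G.Adj i j
  · rw [simplyLaced_of_adj h, pow_three]
    calc f i * f j * (f i * f j * (f i * f j)) = (f i * f j * f i) * (f j * f i * f j) := by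
          simp only [mul_assoc]
      _ = (f i * f j * f i) * (f i * f j * f i) := by rw [hbraid i j h]
      _ = f i * (f j * (f i * f i) * f j) * f i := by simp only [mul_assoc]
      _ = 1 := by simp [hsq]
  · rw [simplyLaced_of_not_adj hij h, pow_two]
    calc f i * f j * (f i * f j) = f i * f j * (f j * f i) := by rw [hcomm i j hij h]
      _ = f i * (f j * f j) * f i := by simp only [mul_assoc]
      _ = 1 := by simp [hsq]

theorem isLiftable_of_apply {X : Type*} (f : P → X → X) (hsq : ∀ i x, f i (f i x) = x)
    (hcomm : ∀ i j, i ≠ j → ¬ G.Adj i j → ∀ x, f i (f j x) = f j (f i x))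
    (hbraid : ∀ i j, G.Adj i j → ∀ x, f i (f j (f i x)) = f j (f i (f j x))) :
    (simplyLaced G).IsLiftable (G := Function.End X) f :=
  isLiftable_simplyLaced (H := Function.End X) f (fun i => funext (hsq i))
    (fun i j hij h => funext (hcomm i j hij h)) (fun i j h => funext (hbraid i j h))

/-! ### The contragredient reflection representation. -/

open Classical in
/-- The entries of the simply-laced Cartan matrix. -/
def cartanEntry (G : SimpleGraph P) (i j : P) : ℤ :=
  if i = j then 2 else if G.Adj i j then -1 else 0

theorem cartanEntry_self (i : P) : cartanEntry G i i = 2 := by simp [cartanEntry]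

theorem cartanEntry_of_adj {i j : P} (h : G.Adj i j) : cartanEntry G i j = -1 := by
  simp [cartanEntry, h, h.ne]

theorem cartanEntry_of_not_adj {i j : P} (hij : i ≠ j) (h : ¬ G.Adj i j) :
    cartanEntry G i j = 0 := by
  simp [cartanEntry, h, hij]

/-- The contragredient reflection action of a simple generator on `ℤ^P`. -/
def coreflection (G : SimpleGraph P) (i : P) (x : P → ℤ) : P → ℤ := fun j =>
  x j - x i * cartanEntry G i j

/-- The maps `coreflection G i` as elements of the monoid of self-maps. -/
def coreflectionEnd (G : SimpleGraph P) (i : P) : Function.End (P → ℤ) := coreflection G i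

/-- The representation serves only to tell generators apart: `s i` negates the `i`-th coordinate of
`e i`, while `s j` with `j ≠ i` fixes `e i`. -/
theorem coreflectionEnd_isLiftable (G : SimpleGraph P) :
    (simplyLaced G).IsLiftable (coreflectionEnd G) := by
  refine isLiftable_of_apply (coreflection G) ?_ ?_ ?_
  · intro i x
    funext k
    simp only [coreflection, cartanEntry_self]; ring
  · intro i j hij h x
    funext k
    have h' : ¬ G.Adj j i := fun e => h e.symm
    simp only [coreflection, cartanEntry_of_not_adj hij h, cartanEntry_of_not_adj hij.symm h']
    ring
  · intro i j h x
    funext k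
    simp only [coreflection, cartanEntry_self, cartanEntry_of_adj h, cartanEntry_of_adj h.symm]
    ring

theorem simple_injective : Function.Injective cs.simple := by
  classical
  intro i j hij
  by_contra hne
  have h := congrArg (cs.lift ⟨_, coreflectionEnd_isLiftable G⟩) hij
  rw [cs.lift_apply_simple, cs.lift_apply_simple] at h
  have : coreflection G i (Pi.single i 1) i = coreflection G j (Pi.single i 1) i :=
    congrFun (congrFun h (Pi.single i 1)) i
  simp [coreflection, Ne.symm hne, cartanEntry_self] at this

/-! ### Parity of inversions and the exchange property. -/

open Classical in
/-- The indicator of equality with values in `ℤ/2`. -/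
def eqIndicator (x y : W) : ZMod 2 := if x = y then 1 else 0

/-- The action of a simple generator on `W × ℤ/2` that conjugates the first component and records
in the second whether it equals the generator. -/
def inversionStep (i : P) (x : W × ZMod 2) : W × ZMod 2 :=
  (cs.simple i * x.1 * cs.simple i, x.2 + eqIndicator x.1 (cs.simple i))

/-- The maps `inversionStep cs i` as elements of the monoid of self-maps. -/
def inversionEnd (i : P) : Function.End (W × ZMod 2) := inversionStep cs i

theorem conj_eq_iff_of_involution {H : Type*} [Group H] {s x y : H} (hs : s * s = 1) :
    s * x * s = y ↔ x = s * y * s := by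
  constructor <;> rintro rfl
  · calc x = (s * s) * x * (s * s) := by simp [hs]
      _ = _ := by simp only [mul_assoc]
  · calc s * (s * y * s) * s = (s * s) * y * (s * s) := by simp only [mul_assoc]
      _ = y := by simp [hs]

theorem eqIndicator_conj {s : W} (hs : s * s = 1) (x y : W) :
    eqIndicator (s * x * s) y = eqIndicator x (s * y * s) := by
  have h := conj_eq_iff_of_involution (x := x) (y := y) hs
  by_cases hx : x = s * y * s
  · simp only [eqIndicator, if_pos hx, if_pos (h.mpr hx)]
  · simp only [eqIndicator, if_neg hx, if_neg (mt h.mp hx)]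

/-- The two sides of a braid relation test the first component against the same three reflections,
`s i`, `s i * s j * s i = s j * s i * s j` and `s j`, in opposite orders; a commutation tests
against `s i` and `s j` either way. -/
theorem inversionEnd_isLiftable : (simplyLaced G).IsLiftable (inversionEnd cs) := by
  have two (z : ZMod 2) : z + z = 0 := CharTwo.add_self_eq_zero z
  have hs := cs.simple_mul_simple_self
  refine isLiftable_of_apply (inversionStep cs) ?_ ?_ ?_
  · intro i x
    simp only [inversionStep,
      eqIndicator_conj (hs i)]
    ext
    · simp [mul_assoc]
    · simp [add_assoc, two]
  · intro i j hij h x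
    have hc := simple_comm cs hij h
    simp only [inversionStep,
      eqIndicator_conj (hs i), eqIndicator_conj (hs j)]
    have e1 : cs.simple j * cs.simple i * cs.simple j = cs.simple i := by
      rw [← hc, mul_assoc, hs, mul_one]
    have e2 : cs.simple i * cs.simple j * cs.simple i = cs.simple j := by
      rw [hc, mul_assoc, hs, mul_one]
    rw [e1, e2]
    ext
    · simp only [← mul_assoc, hc]
      simp only [mul_assoc, hc]
    · simp only; ring
  · intro i j h x
    have hb := simple_braid cs h
    simp only [inversionStep,
      eqIndicator_conj (hs i), eqIndicator_conj (hs j)]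
    have e1 : cs.simple i * (cs.simple j * cs.simple i * cs.simple j) * cs.simple i
        = cs.simple j := by
      rw [← hb]; simp [mul_assoc]
    have e2 : cs.simple j * (cs.simple i * cs.simple j * cs.simple i) * cs.simple j
        = cs.simple i := by
      rw [hb]; simp [mul_assoc]
    rw [e1, e2, hb]
    ext
    · simp only
      calc _ = (cs.simple i * cs.simple j * cs.simple i) * x.1 *
            (cs.simple i * cs.simple j * cs.simple i) := by simp only [mul_assoc]
        _ = _ := by rw [hb]; simp only [mul_assoc]
    · simp only; ring

-- The multiplicity of `t` in the inversion sequence is thereby determined modulo 2 by the group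
-- element alone, not by the word. The word is reversed because products of self-maps act from the
-- right, so that its first letter acts first.
open Classical in
theorem lift_inversionEnd_wordProd_reverse (ω : List P) (t : W) (z : ZMod 2) :
    cs.lift ⟨_, inversionEnd_isLiftable cs⟩ (cs.wordProd ω.reverse) (t, z) =
      ((cs.wordProd ω)⁻¹ * t * cs.wordProd ω, z + (cs.leftInvSeq ω).count t) := by
  induction ω generalizing t z with
  | nil =>
    rw [List.reverse_nil, cs.wordProd_nil, map_one]
    change (t, z) = _
    simp
  | cons i ω ih =>
    rw [List.reverse_cons, cs.wordProd_append, map_mul, cs.wordProd_singleton,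
      cs.lift_apply_simple]
    change cs.lift ⟨_, inversionEnd_isLiftable cs⟩ (cs.wordProd ω.reverse)
      (inversionStep cs i (t, z)) = _
    rw [inversionStep, ih]
    have hcount : (List.map (MulAut.conj (cs.simple i)) (cs.leftInvSeq ω)).count t
        = (cs.leftInvSeq ω).count (cs.simple i * t * cs.simple i) := by
      rw [← List.count_map_of_injective (cs.leftInvSeq ω) _ (MulAut.conj (cs.simple i)).injective]
      simp [mul_assoc]
    ext
    · simp [cs.wordProd_cons, mul_assoc]
    · simp only [CoxeterSystem.leftInvSeq, List.count_cons, hcount, beq_iff_eq, eqIndicator, eq_comm (a := t)]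
      push_cast
      ring

/-- The exchange property of a simply-laced Coxeter group. -/
theorem exists_eraseIdx_of_isLeftDescent {i : P} {ω : List P}
    (h : cs.IsLeftDescent (cs.wordProd ω) i) :
    ∃ k < ω.length, cs.simple i * cs.wordProd ω = cs.wordProd (ω.eraseIdx k) := by
  classical
  obtain ⟨ω', hω', hprod⟩ := cs.exists_isReduced (cs.simple i * cs.wordProd ω)
  have hω : cs.wordProd ω = cs.wordProd (i :: ω') := by
    rw [cs.wordProd_cons, ← hprod, cs.simple_mul_simple_cancel_left]
  -- Both words represent the same element, so they meet the reflection `s i` equally often modulo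
  -- 2.
  have hcount : ((cs.leftInvSeq ω).count (cs.simple i) : ZMod 2)
      = (cs.leftInvSeq (i :: ω')).count (cs.simple i) := by
    have h1 := lift_inversionEnd_wordProd_reverse cs ω (cs.simple i) 0
    have h2 := lift_inversionEnd_wordProd_reverse cs (i :: ω') (cs.simple i) 0
    rw [cs.wordProd_reverse, hω, ← cs.wordProd_reverse, h2] at h1
    simpa using (congrArg Prod.snd h1).symm
  -- Otherwise `s i` would shorten the product of `ω'`, which is `s i` times the given element,
  -- against the descent hypothesis.
  have hnot : cs.simple i ∉ cs.leftInvSeq ω' := by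
    intro hmem
    have := (cs.isLeftInversion_of_mem_leftInvSeq hω' hmem).2
    rw [← hprod, cs.simple_mul_simple_cancel_left] at this
    exact lt_asymm this h
  have hmem : cs.simple i ∈ cs.leftInvSeq ω := by
    by_contra hn
    -- Conjugation by `s i` fixes `s i`, so in `i :: ω'` this reflection occurs exactly once, at the
    -- head; absence from the sequence of `ω` would give `0 = 1` modulo 2.
    have e : ((cs.leftInvSeq ω').map (MulAut.conj (cs.simple i))).count (cs.simple i)
        = (cs.leftInvSeq ω').count (cs.simple i) := by
      rw [← List.count_map_of_injective (cs.leftInvSeq ω') _ (MulAut.conj (cs.simple i)).injective]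
      simp
    rw [List.count_eq_zero_of_not_mem hn, CoxeterSystem.leftInvSeq, List.count_cons, e,
      List.count_eq_zero_of_not_mem hnot] at hcount
    simp at hcount
  obtain ⟨k, hk, hk'⟩ := List.mem_iff_getElem.mp hmem
  refine ⟨k, by simpa using hk, ?_⟩
  rw [← cs.getD_leftInvSeq_mul_wordProd, List.getD_eq_getElem _ 1 hk, hk']

/-! ### Matsumoto's theorem. -/

/-- The equivalence relation on words generated by the commutation and braid moves. -/
inductive BraidEquiv (G : SimpleGraph P) : List P → List P → Prop
  | refl (w) : BraidEquiv G w w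
  | symm {w w'} : BraidEquiv G w w' → BraidEquiv G w' w
  | trans {w w' w''} : BraidEquiv G w w' → BraidEquiv G w' w'' → BraidEquiv G w w''
  | cons (i) {w w'} : BraidEquiv G w w' → BraidEquiv G (i :: w) (i :: w')
  | comm {i j} (w) : i ≠ j → ¬ G.Adj i j → BraidEquiv G (i :: j :: w) (j :: i :: w)
  | braid {i j} (w) : G.Adj i j → BraidEquiv G (i :: j :: i :: w) (j :: i :: j :: w)

theorem isReduced_of_cons {i : P} {w : List P} (h : cs.IsReduced (i :: w)) : cs.IsReduced w :=
  h.drop 1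

/-- If `i` is a left descent of the reduced word `j :: w` and `i ≠ j`, then exchanging `i` does not
remove the first letter. -/
theorem exists_exchange_tail {i j : P} {w : List P} (hw : cs.IsReduced (j :: w)) (hij : i ≠ j)
    (h : cs.IsLeftDescent (cs.wordProd (j :: w)) i) :
    ∃ w', cs.IsReduced (i :: j :: w') ∧ w'.length + 1 = w.length ∧
      cs.wordProd (j :: w) = cs.wordProd (i :: j :: w') := by
  obtain ⟨k, hk, hprod⟩ := exists_eraseIdx_of_isLeftDescent cs h
  rcases k with _ | k
  · rw [List.eraseIdx_cons_zero, cs.wordProd_cons, ← mul_assoc] at hprod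
    have : cs.simple i * cs.simple j = 1 := mul_eq_right.mp hprod
    exact absurd (simple_injective cs ((mul_eq_one_iff_eq_inv.mp this).trans (cs.inv_simple j))) hij
  · rw [List.eraseIdx_cons_succ] at hprod
    have hlen : (w.eraseIdx k).length + 1 = w.length :=
      List.length_eraseIdx_add_one (by simpa using hk)
    have hp : cs.wordProd (j :: w) = cs.wordProd (i :: j :: w.eraseIdx k) := by
      rw [cs.wordProd_cons i, ← hprod, cs.simple_mul_simple_cancel_left]
    refine ⟨w.eraseIdx k, ?_, hlen, hp⟩
    have := hw.eq
    rw [CoxeterSystem.IsReduced, ← hp, this]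
    simp [← hlen]

theorem isLeftDescent_of_isReduced_cons {i : P} {w : List P} (h : cs.IsReduced (i :: w)) :
    cs.IsLeftDescent (cs.wordProd (i :: w)) i := by
  rw [CoxeterSystem.IsLeftDescent, h.eq, cs.wordProd_cons, cs.simple_mul_simple_cancel_left]
  exact (cs.length_wordProd_le w).trans_lt (by simp)

/-- Matsumoto's theorem: reduced words of the same element are related by commutation and braid
moves. -/
theorem braidEquiv_of_isReduced (n : ℕ) (w w' : List P) (hn : w.length = n) (hw : cs.IsReduced w)
    (hw' : cs.IsReduced w') (h : cs.wordProd w = cs.wordProd w') : BraidEquiv G w w' := by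
  induction n using Nat.strong_induction_on generalizing w w' with
  | _ n ih =>
  have hlen : w.length = w'.length := by rw [← hw.eq, ← hw'.eq, h]
  rcases w with _ | ⟨i, a⟩
  · obtain rfl : w' = [] := List.length_eq_zero_iff.mp (by simpa using hlen.symm)
    exact .refl _
  rcases w' with _ | ⟨j, b⟩
  · simp at hlen
  simp only [List.length_cons] at hn hlen
  have same {i a b} (hlt : a.length < n) (ha : cs.IsReduced (i :: a)) (hb : cs.IsReduced (i :: b))
      (hab : cs.wordProd (i :: a) = cs.wordProd (i :: b)) : BraidEquiv G (i :: a) (i :: b) := by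
    refine .cons i (ih _ hlt a b rfl (isReduced_of_cons cs ha) (isReduced_of_cons cs hb) ?_)
    simpa [cs.wordProd_cons] using hab
  by_cases hij : i = j
  · subst hij
    exact same (by omega) hw hw' h
  have di := isLeftDescent_of_isReduced_cons cs hw
  have dj := isLeftDescent_of_isReduced_cons cs hw'
  -- Both `i` and `j` are descents, so the element has a reduced word starting with `j, i`. The plan
  -- is to reach words sharing a first letter with the given ones, where induction applies to the
  -- tails.
  obtain ⟨c, hc, hcl, hcp⟩ := exists_exchange_tail cs hw (Ne.symm hij) (h ▸ dj)
  by_cases hadj : G.Adj i j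
  · have hne : cs.simple i * cs.simple j ≠ cs.simple j * cs.simple i := by
      intro e
      have hb := simple_braid cs hadj
      rw [e, mul_assoc, cs.simple_mul_simple_self, mul_one, mul_assoc, e,
        cs.simple_mul_simple_cancel_left] at hb
      exact hij (simple_injective cs hb).symm
    have di' : cs.IsLeftDescent (cs.wordProd (j :: i :: c)) i := hcp ▸ di
    -- Exchange `i` into `j :: i :: c`: deleting the letter `j` would give `s i = s j`, and deleting
    -- the letter `i` would make the two generators commute. So the deleted letter lies in `c`.
    obtain ⟨d, hdl, hdp⟩ : ∃ d, d.length + 1 = c.length ∧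
        cs.wordProd (j :: i :: c) = cs.wordProd (i :: j :: i :: d) := by
      obtain ⟨k, hk, hprod⟩ := exists_eraseIdx_of_isLeftDescent cs di'
      rcases k with _ | _ | k
      · rw [List.eraseIdx_cons_zero, cs.wordProd_cons j, ← mul_assoc] at hprod
        have : cs.simple i * cs.simple j = 1 := mul_eq_right.mp hprod
        exact absurd (simple_injective cs
          ((mul_eq_one_iff_eq_inv.mp this).trans (cs.inv_simple j))) hij
      · rw [List.eraseIdx_cons_succ, List.eraseIdx_cons_zero] at hprod
        simp only [cs.wordProd_cons, ← mul_assoc, mul_left_inj] at hprod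
        refine absurd ?_ hne
        calc _ = cs.simple i * cs.simple j * cs.simple i * cs.simple i := by simp
          _ = _ := by rw [hprod]
      · refine ⟨c.eraseIdx k, List.length_eraseIdx_add_one (by simpa using hk), ?_⟩
        rw [cs.wordProd_cons i (j :: _), ← List.eraseIdx_cons_succ, ← List.eraseIdx_cons_succ,
          ← hprod, cs.simple_mul_simple_cancel_left]
    have hb : cs.wordProd (i :: j :: i :: d) = cs.wordProd (j :: i :: j :: d) := by
      simp only [cs.wordProd_cons, ← mul_assoc, simple_braid cs hadj]
    have hd1 : cs.IsReduced (i :: j :: i :: d) := by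
      have := hc.eq
      rw [CoxeterSystem.IsReduced, ← hdp, this]; simp [← hdl]
    have hd2 : cs.IsReduced (j :: i :: j :: d) := by
      rw [CoxeterSystem.IsReduced, ← hb, hd1.eq]; simp
    exact (same (by omega) hw hd1 (hcp.trans hdp)).trans ((BraidEquiv.braid d hadj).trans
      (same (by simp; omega) hd2 hw' ((hdp.trans hb).symm.trans (hcp.symm.trans h))))
  · have hp : cs.wordProd (j :: i :: c) = cs.wordProd (i :: j :: c) := by
      simp only [cs.wordProd_cons, ← mul_assoc, simple_comm cs hij hadj]
    have hc2 : cs.IsReduced (i :: j :: c) := by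
      have := hc.eq
      rw [CoxeterSystem.IsReduced, ← hp, this]; simp
    exact (same (by omega) hw hc2 (hcp.trans hp)).trans ((BraidEquiv.comm c hij hadj).trans
      (same (by simp; omega) hc hw' (hcp.symm.trans h)))

end Coxeter

/-! ### Reduced words of a pair -/

section PairWords

variable {P W : Type*} {G : SimpleGraph P} [Group W] (cs : CoxeterSystem (simplyLaced G) W)

/-- An equivalence relation on signed words that is stable under the moves relating the reduced words
of a pair: swapping neighbouring letters of opposite signs, swapping neighbouring letters at
distinct non-adjacent vertices, and braid moves at adjacent vertices. -/
structure IsMoveInvariant (G : SimpleGraph P) (R : List (ℤˣ × P) → List (ℤˣ × P) → Prop) :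
    Prop extends Equivalence R where
  swap_sign (pre post : List (ℤˣ × P)) (e : ℤˣ) (i j : P) :
    R (pre ++ (e, i) :: (-e, j) :: post) (pre ++ (-e, j) :: (e, i) :: post)
  swap_comm (pre post : List (ℤˣ × P)) (e : ℤˣ) (i j : P) (hij : i ≠ j) (h : ¬ G.Adj i j) :
    R (pre ++ (e, i) :: (e, j) :: post) (pre ++ (e, j) :: (e, i) :: post)
  braid (pre post : List (ℤˣ × P)) (e : ℤˣ) (i j : P) (h : G.Adj i j) :
    R (pre ++ (e, i) :: (e, j) :: (e, i) :: post) (pre ++ (e, j) :: (e, i) :: (e, j) :: post)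

/-- The vertices of the letters of sign `e` in a signed word. -/
def signPart (e : ℤˣ) (w : List (ℤˣ × P)) : List P :=
  (w.filter fun a => a.1 = e).map Prod.snd

/-- The signed word with all letters of sign `e` and vertices given by `w`. -/
def signedWord (e : ℤˣ) (w : List P) : List (ℤˣ × P) := w.map fun i => (e, i)

variable {R : List (ℤˣ × P) → List (ℤˣ × P) → Prop}

theorem IsMoveInvariant.signed_word (hR : IsMoveInvariant G R) (e : ℤˣ) {w w' : List P}
    (h : BraidEquiv G w w') (pre post : List (ℤˣ × P)) :
    R (pre ++ signedWord e w ++ post) (pre ++ signedWord e w' ++ post) := by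
  induction h generalizing pre with
  | refl w => exact hR.refl _
  | symm _ ih => exact hR.symm (ih pre)
  | trans _ _ ih₁ ih₂ => exact hR.trans (ih₁ pre) (ih₂ pre)
  | cons i _ ih => simpa [signedWord] using ih (pre ++ [(e, i)])
  | @comm i j w hij h =>
    simpa [signedWord] using hR.swap_comm pre (signedWord e w ++ post) e i j hij h
  | @braid i j w h =>
    simpa [signedWord] using hR.braid pre (signedWord e w ++ post) e i j h

theorem IsMoveInvariant.move_right (hR : IsMoveInvariant G R) (i : P) (w : List P)
    (pre post : List (ℤˣ × P)) :
    R (pre ++ (1, i) :: signedWord (-1) w ++ post)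
      (pre ++ signedWord (-1) w ++ (1, i) :: post) := by
  induction w generalizing pre with
  | nil => simpa [signedWord] using hR.refl _
  | cons j w ih =>
    have h₁ := hR.swap_sign pre (signedWord (-1) w ++ post) 1 i j
    have h₂ := ih (pre ++ [(-1, j)])
    exact hR.trans (by simpa [signedWord] using h₁) (by simpa [signedWord] using h₂)

/-- Letters of opposite signs may always be swapped, so the negative ones can be gathered in front
without changing the order within each sign. -/
theorem IsMoveInvariant.sort (hR : IsMoveInvariant G R) (w pre : List (ℤˣ × P)) :
    R (pre ++ w)
      (pre ++ signedWord (-1) (signPart (-1) w) ++ signedWord 1 (signPart 1 w)) := by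
  induction w generalizing pre with
  | nil => simpa [signedWord, signPart] using hR.refl _
  | cons a w ih =>
    obtain ⟨e, i⟩ := a
    have h := ih (pre ++ [(e, i)])
    rcases Int.units_eq_one_or e with rfl | rfl
    · have h' := hR.move_right i (signPart (-1) w) pre (signedWord 1 (signPart 1 w))
      have := hR.trans (by simpa using h) (by simpa using h')
      simpa [signPart, signedWord] using this
    · simpa [signPart, signedWord] using h

theorem prod_map_letterElement (w : List (ℤˣ × P)) :
    (w.map (letterElement cs)).prod =
      (cs.wordProd (signPart (-1) w), cs.wordProd (signPart 1 w)) := by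
  induction w with
  | nil => simp [signPart, Prod.one_eq_mk]
  | cons a w ih =>
    obtain ⟨e, i⟩ := a
    rw [List.map_cons, List.prod_cons, ih]
    rcases Int.units_eq_one_or e with rfl | rfl <;>
      simp [letterElement, signPart, cs.wordProd_cons]

theorem length_signPart_add (w : List (ℤˣ × P)) :
    (signPart (-1) w).length + (signPart 1 w).length = w.length := by
  induction w with
  | nil => simp [signPart]
  | cons a w ih =>
    obtain ⟨e, i⟩ := a
    rcases Int.units_eq_one_or e with rfl | rfl <;> simp [signPart] at ih ⊢ <;> omega

theorem signPart_signedWord_append (w w' : List P) (e : ℤˣ) :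
    signPart e (signedWord (-1) w ++ signedWord 1 w') = if e = 1 then w' else w := by
  rcases Int.units_eq_one_or e with rfl | rfl <;>
    simp [signPart, signedWord, List.filter_map, Function.comp_def]

/-- The two parts have lengths at least `ℓ(u)` and `ℓ(v)`, while minimality bounds the total by
`ℓ(u) + ℓ(v)`; both inequalities are therefore equalities. -/
theorem isReduced_signPart {u v : W} {m : ℕ} {i : Fin m → ℤˣ × P} (hi : IsReducedWord cs u v i) :
    (cs.IsReduced (signPart (-1) (List.ofFn i)) ∧ cs.wordProd (signPart (-1) (List.ofFn i)) = u) ∧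
      cs.IsReduced (signPart 1 (List.ofFn i)) ∧ cs.wordProd (signPart 1 (List.ofFn i)) = v := by
  obtain ⟨hprod, hmin⟩ := hi
  rw [prod_map_letterElement, Prod.mk.injEq] at hprod
  obtain ⟨a, ha, rfl⟩ := cs.exists_isReduced u
  obtain ⟨b, hb, rfl⟩ := cs.exists_isReduced v
  have h := hmin (signedWord (-1) a ++ signedWord 1 b) (by
    rw [prod_map_letterElement, signPart_signedWord_append, signPart_signedWord_append]; simp)
  have hl := length_signPart_add (List.ofFn i)
  have h1 := cs.length_wordProd_le (signPart (-1) (List.ofFn i))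
  have h2 := cs.length_wordProd_le (signPart 1 (List.ofFn i))
  have h3 := ha.eq
  have h4 := hb.eq
  rw [hprod.1] at h1
  rw [hprod.2] at h2
  simp only [signedWord, List.length_append, List.length_map, List.length_ofFn] at h hl
  refine ⟨⟨?_, hprod.1⟩, ?_, hprod.2⟩
  · rw [CoxeterSystem.IsReduced, hprod.1]; omega
  · rw [CoxeterSystem.IsReduced, hprod.2]; omega

/-- Sort both words by sign and apply Matsumoto's theorem to each block. -/
theorem IsMoveInvariant.of_isReducedWord (hR : IsMoveInvariant G R) {u v : W} {m : ℕ}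
    {i i' : Fin m → ℤˣ × P} (hi : IsReducedWord cs u v i) (hi' : IsReducedWord cs u v i') :
    R (List.ofFn i) (List.ofFn i') := by
  obtain ⟨⟨h1, p1⟩, h2, p2⟩ := isReduced_signPart cs hi
  obtain ⟨⟨h1', p1'⟩, h2', p2'⟩ := isReduced_signPart cs hi'
  have e1 := braidEquiv_of_isReduced cs _ _ _ rfl h1 h1' (p1.trans p1'.symm)
  have e2 := braidEquiv_of_isReduced cs _ _ _ rfl h2 h2' (p2.trans p2'.symm)
  refine hR.trans (by simpa using hR.sort (List.ofFn i) []) (hR.trans ?_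
    (hR.symm (by simpa using hR.sort (List.ofFn i') [])))
  refine hR.trans (by simpa using hR.signed_word (-1) e1 [] _) ?_
  simpa using hR.signed_word 1 e2 (signedWord (-1) (signPart (-1) (List.ofFn i'))) []

end PairWords

/-! ### The form of a word, computed letter by letter

The form of a word is a sum of contributions of its letters. The contribution of a letter at the
vertex `i` involves the coordinate of that letter, the coordinate of the next letter at `i`, and the
coordinates of the next letters at the neighbours of `i`; a coordinate that does not exist counts
as `0`. -/

noncomputable section WordForm

variable {P : Type*}

open Classical in
/-- The coordinate of the first letter at each vertex, in a word whose letters have the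
coordinates `X n, X (n + 1), …`. -/
def firstCoord : List (ℤˣ × P) → ℕ → (ℕ → ℤ) → P → ℤ
  | [], _, _ => 0
  | a :: w, n, X => Function.update (firstCoord w (n + 1) X) a.2 (X n)

theorem firstCoord_congr (w : List (ℤˣ × P)) (n : ℕ) {X X' : ℕ → ℤ} (h : ∀ q, n ≤ q → X q = X' q) :
    firstCoord w n X = firstCoord w n X' := by
  induction w generalizing n with
  | nil => rfl
  | cons a w ih => rw [firstCoord, firstCoord, ih (n + 1) fun q hq => h q (by omega), h n le_rfl]

theorem firstCoord_add (w : List (ℤˣ × P)) (n : ℕ) (X X' : ℕ → ℤ) :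
    firstCoord w n (X + X') = firstCoord w n X + firstCoord w n X' := by
  induction w generalizing n with
  | nil => simp [firstCoord]
  | cons a w ih =>
    rw [firstCoord, firstCoord, firstCoord, ih (n + 1)]
    funext j
    by_cases h : j = a.2
    · subst h; simp
    · simp [h]

theorem firstCoord_smul (w : List (ℤˣ × P)) (n : ℕ) (r : ℤ) (X : ℕ → ℤ) :
    firstCoord w n (r • X) = r • firstCoord w n X := by
  induction w generalizing n with
  | nil => simp [firstCoord]
  | cons a w ih =>
    rw [firstCoord, firstCoord, ih (n + 1)]
    funext j
    by_cases h : j = a.2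
    · subst h; simp
    · simp [h]

theorem firstCoord_eq_zero (w : List (ℤˣ × P)) (n : ℕ) {X : ℕ → ℤ} (h : ∀ q, n ≤ q → X q = 0) :
    firstCoord w n X = 0 := by
  rw [firstCoord_congr w n (X' := (0 : ℤ) • X) (by simpa using h), firstCoord_smul, zero_smul]

-- A position is read off at its own vertex, or nowhere if an earlier letter at that vertex hides
-- it. This is why the functional of the reflection takes only the values `0` and `1` on the basis
-- vectors it is applied to.
open Classical in
theorem firstCoord_single (w : List (ℤˣ × P)) (n k : ℕ) :
    firstCoord w n (Pi.single k 1) = 0 ∨ ∃ j, firstCoord w n (Pi.single k 1) = Pi.single j 1 := by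
  induction w generalizing n with
  | nil => exact .inl rfl
  | cons a w ih =>
    rw [firstCoord]
    by_cases hk : n = k
    · subst hk
      rw [firstCoord_eq_zero w (n + 1) fun q hq => Pi.single_eq_of_ne (by omega) _]
      exact .inr ⟨a.2, by simp [Pi.single]⟩
    · rw [Pi.single_eq_of_ne hk]
      rcases ih (n + 1) with h | ⟨j, h⟩
      · exact .inl (by rw [h]; exact Function.update_eq_self a.2 (0 : P → ℤ))
      · by_cases hj : a.2 = j
        · refine .inl ?_
          rw [h, hj]
          simp [Pi.single]
        · refine .inr ⟨j, ?_⟩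
          rw [h]
          nth_rw 2 [← Function.update_eq_self a.2 (Pi.single j 1 : P → ℤ)]
          rw [Pi.single_eq_of_ne hj]

theorem firstCoord_append_congr (pre : List (ℤˣ × P)) {w w' : List (ℤˣ × P)} (n : ℕ)
    {X X' : ℕ → ℤ} (h : ∀ q, n ≤ q → q < n + pre.length → X q = X' q)
    (hc : firstCoord w (n + pre.length) X = firstCoord w' (n + pre.length) X') :
    firstCoord (pre ++ w) n X = firstCoord (pre ++ w') n X' := by
  induction pre generalizing n with
  | nil => simpa using hc
  | cons a pre ih =>
    simp only [List.length_cons] at h hc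
    rw [List.cons_append, List.cons_append, firstCoord, firstCoord, h n le_rfl (by omega),
      ih (n + 1) (fun q h1 h2 => h q (by omega) (by omega))
      (by rw [show n + 1 + pre.length = n + (pre.length + 1) by ring]; exact hc)]

open Classical in
theorem firstCoord_append_eq_zero (pre : List (ℤˣ × P)) {w : List (ℤˣ × P)} (n : ℕ) {X : ℕ → ℤ}
    (h : ∀ q, n ≤ q → q < n + pre.length → X q = 0) (hc : firstCoord w (n + pre.length) X = 0) :
    firstCoord (pre ++ w) n X = 0 := by
  induction pre generalizing n with
  | nil => simpa using hc
  | cons a pre ih =>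
    simp only [List.length_cons] at h hc
    rw [List.cons_append, firstCoord, h n le_rfl (by omega),
      ih (n + 1) (fun q h1 h2 => h q (by omega) (by omega))
      (by rw [show n + 1 + pre.length = n + (pre.length + 1) by ring]; exact hc)]
    exact Function.update_eq_self a.2 (0 : P → ℤ)

variable [Fintype P] (G : SimpleGraph P)

open Classical in
/-- The sum of the values at the neighbours of a vertex. -/
def neighborSum (c : P → ℤ) (i : P) : ℤ := ∑ j, if G.Adj i j then c j else 0

theorem neighborSum_add (c d : P → ℤ) (i : P) :
    neighborSum G (c + d) i = neighborSum G c i + neighborSum G d i := by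
  rw [neighborSum, neighborSum, neighborSum, ← Finset.sum_add_distrib]
  refine Finset.sum_congr rfl fun j _ => ?_
  split_ifs <;> simp

theorem neighborSum_zero (i : P) : neighborSum G 0 i = 0 := by simp [neighborSum]

open Classical in
theorem neighborSum_update (c : P → ℤ) (i j : P) (v : ℤ) :
    neighborSum G (Function.update c j v) i =
      neighborSum G c i + if G.Adj i j then v - c j else 0 := by
  have : Function.update c j v = c + Pi.single j (v - c j) := by
    funext k
    by_cases h : k = j
    · subst h; simp
    · simp [h]
  rw [this, neighborSum_add]
  congr 1
  rw [neighborSum, Finset.sum_eq_single j]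
  · simp
  · intro k _ hk; simp [hk]
  · simp

theorem neighborSum_update_of_adj [DecidableEq P] (c : P → ℤ) {i j : P} (v : ℤ) (h : G.Adj i j) :
    neighborSum G (Function.update c j v) i = neighborSum G c i + (v - c j) := by
  classical
  have := neighborSum_update G c i j v
  rw [if_pos h] at this
  convert this

theorem neighborSum_update_of_not_adj [DecidableEq P] (c : P → ℤ) {i j : P} (v : ℤ)
    (h : ¬ G.Adj i j) : neighborSum G (Function.update c j v) i = neighborSum G c i := by
  classical
  have := neighborSum_update G c i j v
  rw [if_neg h, add_zero] at this
  convert this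

theorem neighborSum_update_self [DecidableEq P] (c : P → ℤ) (i : P) (v : ℤ) :
    neighborSum G (Function.update c i v) i = neighborSum G c i :=
  neighborSum_update_of_not_adj G c v G.irrefl

theorem neighborSum_single_self [DecidableEq P] (i : P) (v : ℤ) :
    neighborSum G (Pi.single i v) i = 0 := by
  rw [Pi.single, neighborSum_update_self]
  exact neighborSum_zero G i

/-- The contribution of a letter with coordinates `x`, `y`, where `c` and `d` give the coordinates
of the next letters at all vertices. -/
def letterForm (a : ℤˣ × P) (x y : ℤ) (c d : P → ℤ) : ℤ :=
  a.1 * (2 * (x * d a.2 - c a.2 * y) + (c a.2 - x) * neighborSum G d a.2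
    - neighborSum G c a.2 * (d a.2 - y))

/-- The alternating form of a word: twice the form `omega` of its graph, up to terms between
letters that are the first at their vertices. -/
def wordForm : List (ℤˣ × P) → ℕ → (ℕ → ℤ) → (ℕ → ℤ) → ℤ
  | [], _, _, _ => 0
  | a :: w, n, X, Y =>
    letterForm G a (X n) (Y n) (firstCoord w (n + 1) X) (firstCoord w (n + 1) Y)
      + wordForm w (n + 1) X Y

theorem wordForm_congr (w : List (ℤˣ × P)) (n : ℕ) {X X' Y Y' : ℕ → ℤ}
    (hX : ∀ q, n ≤ q → X q = X' q) (hY : ∀ q, n ≤ q → Y q = Y' q) :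
    wordForm G w n X Y = wordForm G w n X' Y' := by
  induction w generalizing n with
  | nil => rfl
  | cons a w ih =>
    have hX' : ∀ q, n + 1 ≤ q → X q = X' q := fun q hq => hX q (by omega)
    have hY' : ∀ q, n + 1 ≤ q → Y q = Y' q := fun q hq => hY q (by omega)
    rw [wordForm, wordForm, ih (n + 1) hX' hY', firstCoord_congr w _ hX', firstCoord_congr w _ hY',
      hX n le_rfl, hY n le_rfl]

theorem wordForm_add_right (w : List (ℤˣ × P)) (n : ℕ) (X Y Y' : ℕ → ℤ) :
    wordForm G w n X (Y + Y') = wordForm G w n X Y + wordForm G w n X Y' := by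
  induction w generalizing n with
  | nil => simp [wordForm]
  | cons a w ih =>
    rw [wordForm, wordForm, wordForm, ih (n + 1), firstCoord_add]
    simp only [letterForm, neighborSum_add, Pi.add_apply]
    ring

theorem wordForm_swap (w : List (ℤˣ × P)) (n : ℕ) (X Y : ℕ → ℤ) :
    wordForm G w n Y X = - wordForm G w n X Y := by
  induction w generalizing n with
  | nil => simp [wordForm]
  | cons a w ih =>
    rw [wordForm, wordForm, ih (n + 1)]
    simp only [letterForm]
    ring

theorem wordForm_zero_right (w : List (ℤˣ × P)) (n : ℕ) (X : ℕ → ℤ) :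
    wordForm G w n X 0 = 0 := by
  have := wordForm_add_right G w n X 0 0
  rw [add_zero] at this
  omega

theorem wordForm_eq_zero (w : List (ℤˣ × P)) (n : ℕ) {X Y : ℕ → ℤ} (h : ∀ q, n ≤ q → Y q = 0) :
    wordForm G w n X Y = 0 :=
  (wordForm_congr G w n (fun _ _ => rfl) h).trans (wordForm_zero_right G w n X)

/-- Locality: the terms of the prefix involve the remaining word only through its first coordinates.
A move thus has to be checked on its own letters, provided that it preserves these. -/
theorem wordForm_append_congr (pre : List (ℤˣ × P)) {w w' : List (ℤˣ × P)} (n : ℕ)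
    {X X' Y Y' : ℕ → ℤ} (hX : ∀ q, n ≤ q → q < n + pre.length → X q = X' q)
    (hY : ∀ q, n ≤ q → q < n + pre.length → Y q = Y' q)
    (hcX : firstCoord w (n + pre.length) X = firstCoord w' (n + pre.length) X')
    (hcY : firstCoord w (n + pre.length) Y = firstCoord w' (n + pre.length) Y')
    (hw : wordForm G w (n + pre.length) X Y = wordForm G w' (n + pre.length) X' Y') :
    wordForm G (pre ++ w) n X Y = wordForm G (pre ++ w') n X' Y' := by
  induction pre generalizing n with
  | nil => simpa using hw
  | cons a pre ih =>
    simp only [List.length_cons] at hX hY hcX hcY hw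
    rw [show n + (pre.length + 1) = n + 1 + pre.length by ring] at hcX hcY hw
    have hX' : ∀ q, n + 1 ≤ q → q < n + 1 + pre.length → X q = X' q :=
      fun q h1 h2 => hX q (by omega) (by omega)
    have hY' : ∀ q, n + 1 ≤ q → q < n + 1 + pre.length → Y q = Y' q :=
      fun q h1 h2 => hY q (by omega) (by omega)
    rw [List.cons_append, List.cons_append, wordForm, wordForm, ih (n + 1) hX' hY' hcX hcY hw,
      hX n le_rfl (by omega), hY n le_rfl (by omega),
      firstCoord_append_congr pre (n + 1) hX' hcX, firstCoord_append_congr pre (n + 1) hY' hcY]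

theorem wordForm_append_of_eq_zero (pre : List (ℤˣ × P)) {w : List (ℤˣ × P)} (n : ℕ)
    {X Y : ℕ → ℤ} (hY : ∀ q, n ≤ q → q < n + pre.length → Y q = 0)
    (hcY : firstCoord w (n + pre.length) Y = 0) :
    wordForm G (pre ++ w) n X Y = wordForm G w (n + pre.length) X Y := by
  induction pre generalizing n with
  | nil => simp
  | cons a pre ih =>
    simp only [List.length_cons] at hY hcY ⊢
    rw [show n + (pre.length + 1) = n + 1 + pre.length by ring] at hcY ⊢
    have hY' : ∀ q, n + 1 ≤ q → q < n + 1 + pre.length → Y q = 0 :=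
      fun q h1 h2 => hY q (by omega) (by omega)
    have h0 := firstCoord_append_eq_zero pre (n + 1) hY' hcY
    rw [List.cons_append, wordForm, ih (n + 1) hY' hcY, h0, hY n le_rfl (by omega), letterForm]
    simp [neighborSum_zero]

/-! ### The word form under the moves. -/

/-- The form is preserved by a swap of neighbouring letters at distinct vertices. -/
theorem wordForm_swap_letters (pre post : List (ℤˣ × P)) {a b : ℤˣ × P} (hab : a.2 ≠ b.2)
    (h : b.1 = -a.1 ∨ ¬ G.Adj a.2 b.2) {X X' Y Y' : ℕ → ℤ}
    (hX : X' (pre.length) = X (pre.length + 1)) (hX1 : X' (pre.length + 1) = X pre.length)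
    (hX2 : ∀ q, q < pre.length ∨ pre.length + 2 ≤ q → X' q = X q)
    (hY : Y' (pre.length) = Y (pre.length + 1)) (hY1 : Y' (pre.length + 1) = Y pre.length)
    (hY2 : ∀ q, q < pre.length ∨ pre.length + 2 ≤ q → Y' q = Y q) :
    wordForm G (pre ++ b :: a :: post) 0 X' Y' = wordForm G (pre ++ a :: b :: post) 0 X Y := by
  classical
  have hcX := firstCoord_congr post (pre.length + 2) fun q hq => hX2 q (.inr hq)
  have hcY := firstCoord_congr post (pre.length + 2) fun q hq => hY2 q (.inr hq)
  have hf := wordForm_congr G post (pre.length + 2) (fun q hq => hX2 q (.inr hq))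
    (fun q hq => hY2 q (.inr hq))
  refine wordForm_append_congr G pre 0 (fun q _ hq => hX2 q (.inl (by omega)))
    (fun q _ hq => hY2 q (.inl (by omega))) ?_ ?_ ?_
  · simp only [firstCoord, zero_add, add_assoc, Nat.reduceAdd, hX, hX1, hcX]
    exact Function.update_comm hab ..
  · simp only [firstCoord, zero_add, add_assoc, Nat.reduceAdd, hY, hY1, hcY]
    exact Function.update_comm hab ..
  · simp only [firstCoord, wordForm, zero_add, add_assoc, Nat.reduceAdd, hX, hX1, hcX, hY, hY1,
      hcY, hf, letterForm]
    rw [Function.update_of_ne hab, Function.update_of_ne hab, Function.update_of_ne hab.symm,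
      Function.update_of_ne hab.symm]
    by_cases hadj : G.Adj a.2 b.2
    · have hs : b.1 = -a.1 := h.resolve_right (not_not.mpr hadj)
      simp only [neighborSum_update_of_adj G _ _ hadj, neighborSum_update_of_adj G _ _ hadj.symm, hs]
      push_cast
      ring
    · have hadj' : ¬ G.Adj b.2 a.2 := fun e => hadj e.symm
      simp only [neighborSum_update_of_not_adj G _ _ hadj,
        neighborSum_update_of_not_adj G _ _ hadj']
      ring

/-- The form is preserved by a swap of neighbouring letters of opposite signs at the same vertex,
if the coordinate between them is replaced. -/
theorem wordForm_swap_sign (pre post : List (ℤˣ × P)) (e : ℤˣ) (i : P) {X X' Y Y' : ℕ → ℤ}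
    (hX1 : X' (pre.length + 1) =
      X pre.length + firstCoord post (pre.length + 2) X i - X (pre.length + 1))
    (hX2 : ∀ q, q ≠ pre.length + 1 → X' q = X q)
    (hY1 : Y' (pre.length + 1) =
      Y pre.length + firstCoord post (pre.length + 2) Y i - Y (pre.length + 1))
    (hY2 : ∀ q, q ≠ pre.length + 1 → Y' q = Y q) :
    wordForm G (pre ++ (-e, i) :: (e, i) :: post) 0 X' Y' =
      wordForm G (pre ++ (e, i) :: (-e, i) :: post) 0 X Y := by
  classical
  have hcX := firstCoord_congr post (pre.length + 2) fun q hq => hX2 q (by omega)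
  have hcY := firstCoord_congr post (pre.length + 2) fun q hq => hY2 q (by omega)
  have hf := wordForm_congr G post (pre.length + 2) (fun q hq => hX2 q (by omega))
    (fun q hq => hY2 q (by omega))
  have hX := hX2 pre.length (by omega)
  have hY := hY2 pre.length (by omega)
  refine wordForm_append_congr G pre 0 (fun q _ hq => hX2 q (by omega))
    (fun q _ hq => hY2 q (by omega)) ?_ ?_ ?_
  · simp only [firstCoord, zero_add, add_assoc, Nat.reduceAdd, hX, hcX, Function.update_idem]
  · simp only [firstCoord, zero_add, add_assoc, Nat.reduceAdd, hY, hcY, Function.update_idem]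
  -- With outer, inner and next coordinates `x`, `y`, `c` at `i` and neighbour sum `N`, the two
  -- letters contribute `e` times `2 (x + c) ∧ y + (2 y - x - c) ∧ N`. Replacing `y` by `x + c - y`
  -- negates this, as does exchanging the signs.
  · simp only [firstCoord, wordForm, zero_add, add_assoc, Nat.reduceAdd, hX, hX1, hcX, hY, hY1,
      hcY, hf, letterForm, Function.update_self, neighborSum_update_self]
    push_cast
    ring

/-- This exhibits the two sign classes of neighbours of the reflected index: the previous and next
letters at `i` against the next letters at adjacent vertices. The first class is the functional used
in the reflection. -/
theorem wordForm_single_of_swap_sign (pre post : List (ℤˣ × P)) (e : ℤˣ) (i : P) (X : ℕ → ℤ) :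
    wordForm G (pre ++ (e, i) :: (-e, i) :: post) 0 X (Pi.single (pre.length + 1) 1) =
      2 * e * (X pre.length + firstCoord post (pre.length + 2) X i
        - neighborSum G (firstCoord post (pre.length + 2) X) i) := by
  classical
  have hc : firstCoord post (pre.length + 2) (Pi.single (pre.length + 1) 1) = 0 :=
    firstCoord_eq_zero post _ fun q hq => Pi.single_eq_of_ne (by omega) _
  rw [wordForm_append_of_eq_zero]
  · have hf : wordForm G post (pre.length + 2) X (Pi.single (pre.length + 1) 1) = 0 :=
      wordForm_eq_zero G post _ fun q hq => Pi.single_eq_of_ne (by omega) _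
    simp only [firstCoord, wordForm, zero_add, add_assoc, Nat.reduceAdd, hf, hc, letterForm,
      Function.update_self, neighborSum_update_self, neighborSum_zero, Pi.single_eq_same,
      Pi.single_eq_of_ne (show pre.length ≠ pre.length + 1 by omega), Pi.zero_apply]
    push_cast
    ring
  · intro q _ hq; exact Pi.single_eq_of_ne (by omega) _
  · simp [firstCoord, add_assoc, hc]

/-- The form is preserved by a braid move, if the two outer coordinates are swapped and the inner
one is replaced. -/
theorem wordForm_braid (pre post : List (ℤˣ × P)) (e : ℤˣ) {i j : P} (h : G.Adj i j)
    {X X' Y Y' : ℕ → ℤ}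
    (hX : X' (pre.length) = X (pre.length + 1)) (hX1 : X' (pre.length + 1) = X pre.length)
    (hX2 : X' (pre.length + 2) =
      X pre.length + firstCoord post (pre.length + 3) X j - X (pre.length + 2))
    (hX3 : ∀ q, q < pre.length ∨ pre.length + 3 ≤ q → X' q = X q)
    (hY : Y' (pre.length) = Y (pre.length + 1)) (hY1 : Y' (pre.length + 1) = Y pre.length)
    (hY2 : Y' (pre.length + 2) =
      Y pre.length + firstCoord post (pre.length + 3) Y j - Y (pre.length + 2))
    (hY3 : ∀ q, q < pre.length ∨ pre.length + 3 ≤ q → Y' q = Y q) :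
    wordForm G (pre ++ (e, j) :: (e, i) :: (e, j) :: post) 0 X' Y' =
      wordForm G (pre ++ (e, i) :: (e, j) :: (e, i) :: post) 0 X Y := by
  classical
  have hij := h.ne
  have hcX := firstCoord_congr post (pre.length + 3) fun q hq => hX3 q (.inr hq)
  have hcY := firstCoord_congr post (pre.length + 3) fun q hq => hY3 q (.inr hq)
  have hf := wordForm_congr G post (pre.length + 3) (fun q hq => hX3 q (.inr hq))
    (fun q hq => hY3 q (.inr hq))
  refine wordForm_append_congr G pre 0 (fun q _ hq => hX3 q (.inl (by omega)))
    (fun q _ hq => hY3 q (.inl (by omega))) ?_ ?_ ?_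
  · simp only [firstCoord, zero_add, add_assoc, Nat.reduceAdd, hX, hX1, hcX]
    funext k
    simp only [Function.update_apply]
    split_ifs <;> simp_all
  · simp only [firstCoord, zero_add, add_assoc, Nat.reduceAdd, hY, hY1, hcY]
    funext k
    simp only [Function.update_apply]
    split_ifs <;> simp_all
  · simp only [firstCoord, wordForm, zero_add, add_assoc, Nat.reduceAdd, hX, hX1, hX2, hcX, hY, hY1,
      hY2, hcY, hf, letterForm, Function.update_self, neighborSum_update_self,
      neighborSum_update_of_adj G _ _ h, neighborSum_update_of_adj G _ _ h.symm,
      Function.update_of_ne hij, Function.update_of_ne hij.symm]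
    ring

/-- As for the swap of signs, the coefficients show which indices pair to `±1` with the reflected
one. One sign class consists of the middle letter and the next letter at `i`. -/
theorem wordForm_single_of_braid (pre post : List (ℤˣ × P)) (e : ℤˣ) {i j : P} (h : G.Adj i j)
    (X : ℕ → ℤ) :
    wordForm G (pre ++ (e, i) :: (e, j) :: (e, i) :: post) 0 X (Pi.single (pre.length + 2) 1) =
      2 * e * (X pre.length - X (pre.length + 1) + firstCoord post (pre.length + 3) X j
        - firstCoord post (pre.length + 3) X i) := by
  classical
  have hij := h.ne
  have hc : firstCoord post (pre.length + 3) (Pi.single (pre.length + 2) 1) = 0 :=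
    firstCoord_eq_zero post _ fun q hq => Pi.single_eq_of_ne (by omega) _
  rw [wordForm_append_of_eq_zero]
  · have hf : wordForm G post (pre.length + 3) X (Pi.single (pre.length + 2) 1) = 0 :=
      wordForm_eq_zero G post _ fun q hq => Pi.single_eq_of_ne (by omega) _
    simp only [firstCoord, wordForm, zero_add, add_assoc, Nat.reduceAdd, hf, hc, letterForm,
      Function.update_self, neighborSum_update_self, neighborSum_zero, Pi.single_eq_same,
      neighborSum_update_of_adj G _ _ h, neighborSum_update_of_adj G _ _ h.symm,
      Function.update_of_ne hij, Function.update_of_ne hij.symm,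
      Pi.single_eq_of_ne (show pre.length ≠ pre.length + 2 by omega),
      Pi.single_eq_of_ne (show pre.length + 1 ≠ pre.length + 2 by omega), Pi.zero_apply]
    ring
  · intro q _ hq; exact Pi.single_eq_of_ne (by omega) _
  · simp only [firstCoord, zero_add, add_assoc, Nat.reduceAdd, hc,
      Pi.single_eq_of_ne (show pre.length ≠ pre.length + 2 by omega),
      Pi.single_eq_of_ne (show pre.length + 1 ≠ pre.length + 2 by omega)]
    funext k
    simp only [Function.update_apply]
    split_ifs <;> simp_all

end WordForm

/-! ### Comparison with the form of the word graph -/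

noncomputable section Comparison

variable {P : Type*} {m : ℕ}

open Classical in
theorem prevIndex_eq_coe_iff {i : Fin m → ℤˣ × P} {p q : Fin m} :
    prevIndex i q = p ↔ p < q ∧ (i p).2 = (i q).2 ∧ ∀ r < q, (i r).2 = (i q).2 → r ≤ p := by
  rw [prevIndex]
  constructor
  · intro h
    have h1 := Finset.mem_of_max h
    refine ⟨by simpa using (Finset.mem_filter.mp h1).2.1, (Finset.mem_filter.mp h1).2.2, ?_⟩
    intro r hr hr'
    exact Finset.le_max_of_eq (Finset.mem_filter.mpr ⟨Finset.mem_univ _, hr, hr'⟩) h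
  · rintro ⟨h1, h2, h3⟩
    refine le_antisymm (Finset.max_le fun r hr => ?_)
      (Finset.le_max (Finset.mem_filter.mpr ⟨Finset.mem_univ _, h1, h2⟩))
    obtain ⟨_, hr1, hr2⟩ := Finset.mem_filter.mp hr
    exact WithBot.coe_le_coe.mpr (h3 r hr1 hr2)

open Classical in
theorem prevIndex_lt_coe_iff {i : Fin m → ℤˣ × P} {p q : Fin m} :
    prevIndex i q < p ↔ ∀ r < q, (i r).2 = (i q).2 → r < p := by
  rw [prevIndex, Finset.max, Finset.sup_lt_iff (WithBot.bot_lt_coe p)]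
  simp

open Classical in
theorem prevIndex_eq_bot_iff {i : Fin m → ℤˣ × P} {q : Fin m} :
    prevIndex i q = ⊥ ↔ ∀ r < q, (i r).2 ≠ (i q).2 := by
  rw [prevIndex, Finset.max_eq_bot, Finset.filter_eq_empty_iff]
  simp

theorem mem_boundedIndices_iff {i : Fin m → ℤˣ × P} {q : Fin m} :
    q ∈ boundedIndices i ↔ ∃ r < q, (i r).2 = (i q).2 := by
  rw [boundedIndices, Set.mem_ofPred_eq, Ne, prevIndex_eq_bot_iff]
  push Not
  rfl

/-- Extension of a vector by zero to all natural numbers. -/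
def extendZero (x : Fin m → ℤ) (n : ℕ) : ℤ := if h : n < m then x ⟨n, h⟩ else 0

open Classical in
/-- The sum of the coordinates of the letters with previous index `p`. -/
def nextCoord (i : Fin m → ℤˣ × P) (x : Fin m → ℤ) (p : Fin m) : ℤ :=
  ∑ q, if prevIndex i q = p then x q else 0

open Classical in
/-- The sum of the coordinates of the letters that follow `p` immediately at neighbouring
vertices. -/
def neighborCoord (G : SimpleGraph P) (i : Fin m → ℤˣ × P) (x : Fin m → ℤ) (p : Fin m) : ℤ :=
  ∑ q, if G.Adj (i p).2 (i q).2 ∧ prevIndex i q < p ∧ p < q then x q else 0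

-- The dictionary between the recursion and indices: the first letters at their vertices are those
-- without a previous index. Through it `wordForm_ofFn` unrolls the recursive form into a sum over
-- positions.
open Classical in
theorem firstCoord_ofFn (i : Fin m → ℤˣ × P) (n : ℕ) (X : ℕ → ℤ) (j : P) :
    firstCoord (List.ofFn i) n X j =
      ∑ q : Fin m, if prevIndex i q = ⊥ ∧ (i q).2 = j then X (n + q) else 0 := by
  induction m generalizing n with
  | zero => simp [firstCoord]
  | succ m ih =>
    rw [List.ofFn_succ, firstCoord, Fin.sum_univ_succ, Function.update_apply, ih]
    have h0 : prevIndex i 0 = ⊥ := prevIndex_eq_bot_iff.mpr fun r hr => absurd hr (by simp)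
    by_cases hj : j = (i 0).2
    · subst hj
      rw [if_pos rfl, if_pos ⟨h0, rfl⟩, Finset.sum_eq_zero]
      · simp
      · intro q _
        rw [if_neg]
        rintro ⟨h1, h2⟩
        exact prevIndex_eq_bot_iff.mp h1 0 (Fin.succ_pos q) h2.symm
    · rw [if_neg hj, if_neg (fun h => hj h.2.symm), zero_add]
      refine Finset.sum_congr rfl fun q _ => ?_
      have : (n + 1 + (q : ℕ)) = n + (q.succ : ℕ) := by simp; ring
      rw [this]
      refine if_congr (and_congr_left fun hq => ?_) rfl rfl
      rw [prevIndex_eq_bot_iff, prevIndex_eq_bot_iff, Fin.forall_fin_succ]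
      simp only [Fin.succ_lt_succ_iff]
      exact ⟨fun h => ⟨fun _ e => hj (hq ▸ e).symm, h⟩, fun h => h.2⟩

open Classical in
theorem nextCoord_succ (i : Fin (m + 1) → ℤˣ × P) (x : Fin (m + 1) → ℤ) (p : Fin m) :
    nextCoord i x p.succ = nextCoord (fun q => i q.succ) (fun q => x q.succ) p := by
  rw [nextCoord, nextCoord, Fin.sum_univ_succ, if_neg, zero_add]
  · refine Finset.sum_congr rfl fun q _ => if_congr ?_ rfl rfl
    rw [prevIndex_eq_coe_iff, prevIndex_eq_coe_iff, Fin.forall_fin_succ]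
    simp
  · rw [prevIndex_eq_coe_iff]
    simp

open Classical in
theorem nextCoord_zero (i : Fin (m + 1) → ℤˣ × P) (n : ℕ) (X : ℕ → ℤ) :
    nextCoord i (fun q => X (n + q)) 0 =
      firstCoord (List.ofFn fun q => i (Fin.succ q)) (n + 1) X (i 0).2 := by
  rw [nextCoord, firstCoord_ofFn, Fin.sum_univ_succ, if_neg, zero_add]
  · refine Finset.sum_congr rfl fun q _ => if_congr ?_ (by simp; ring_nf) rfl
    rw [prevIndex_eq_coe_iff, prevIndex_eq_bot_iff, Fin.forall_fin_succ]
    simp only [Fin.succ_lt_succ_iff]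
    constructor
    · rintro ⟨_, h1, _, h2⟩
      exact ⟨fun r hr e => absurd (h2 r hr e) (by simp), h1.symm⟩
    · rintro ⟨h1, h2⟩
      exact ⟨Fin.succ_pos q, h2.symm, fun _ _ => le_rfl, fun r hr e => absurd e (h1 r hr)⟩
  · rw [prevIndex_eq_coe_iff]
    simp

open Classical in
theorem nextCoord_single (i : Fin m → ℤˣ × P) (k p : Fin m) :
    nextCoord i (Pi.single k 1) p = if prevIndex i k = p then 1 else 0 := by
  rw [nextCoord, Finset.sum_eq_single k]
  · simp
  · intro q _ hq; simp [hq]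
  · simp

open Classical in
theorem neighborCoord_single (G : SimpleGraph P) (i : Fin m → ℤˣ × P) (k p : Fin m) :
    neighborCoord G i (Pi.single k 1) p =
      if G.Adj (i p).2 (i k).2 ∧ prevIndex i k < p ∧ p < k then 1 else 0 := by
  rw [neighborCoord, Finset.sum_eq_single k]
  · simp
  · intro q _ hq; simp [hq]
  · simp

open Classical in
theorem neighborCoord_succ (G : SimpleGraph P) (i : Fin (m + 1) → ℤˣ × P) (x : Fin (m + 1) → ℤ) (p : Fin m) :
    neighborCoord G i x p.succ = neighborCoord G (fun q => i q.succ) (fun q => x q.succ) p := by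
  rw [neighborCoord, neighborCoord, Fin.sum_univ_succ, if_neg, zero_add]
  · refine Finset.sum_congr rfl fun q _ => if_congr ?_ rfl rfl
    rw [prevIndex_lt_coe_iff, prevIndex_lt_coe_iff, Fin.forall_fin_succ]
    simp
  · simp

variable [Fintype P] (G : SimpleGraph P)

open Classical in
theorem neighborSum_firstCoord_ofFn (i : Fin m → ℤˣ × P) (n : ℕ) (X : ℕ → ℤ) (j : P) :
    neighborSum G (firstCoord (List.ofFn i) n X) j =
      ∑ q : Fin m, if prevIndex i q = ⊥ ∧ G.Adj j (i q).2 then X (n + q) else 0 := by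
  have (k : P) : (if G.Adj j k then firstCoord (List.ofFn i) n X k else 0) =
      ∑ q : Fin m, if G.Adj j k ∧ prevIndex i q = ⊥ ∧ (i q).2 = k then X (n + q) else 0 := by
    rw [firstCoord_ofFn]
    by_cases h : G.Adj j k <;> simp [h]
  rw [neighborSum, Finset.sum_congr rfl fun k _ => this k, Finset.sum_comm]
  refine Finset.sum_congr rfl fun q _ => ?_
  rw [Finset.sum_eq_single (i q).2]
  · exact if_congr (by tauto) rfl rfl
  · intro k _ hk
    rw [if_neg (fun h => hk h.2.2.symm)]
  · simp

open Classical in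
theorem neighborCoord_zero (i : Fin (m + 1) → ℤˣ × P) (n : ℕ) (X : ℕ → ℤ) :
    neighborCoord G i (fun q => X (n + q)) 0 =
      neighborSum G (firstCoord (List.ofFn fun q => i (Fin.succ q)) (n + 1) X) (i 0).2 := by
  rw [neighborCoord, neighborSum_firstCoord_ofFn, Fin.sum_univ_succ, if_neg, zero_add]
  · refine Finset.sum_congr rfl fun q _ => if_congr ?_ (by simp; ring_nf) rfl
    rw [prevIndex_lt_coe_iff, prevIndex_eq_bot_iff, Fin.forall_fin_succ]
    simp only [Fin.succ_lt_succ_iff]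
    constructor
    · rintro ⟨h1, ⟨_, h2⟩, _⟩
      exact ⟨fun r hr e => absurd (h2 r hr e) (by simp), h1⟩
    · rintro ⟨h1, h2⟩
      exact ⟨h2, ⟨fun _ e => absurd e h2.ne, fun r hr e => absurd e (h1 r hr)⟩, Fin.succ_pos q⟩
  · simp

theorem wordForm_ofFn (i : Fin m → ℤˣ × P) (n : ℕ) (X Y : ℕ → ℤ) :
    wordForm G (List.ofFn i) n X Y = ∑ p : Fin m, ((i p).1 : ℤ) *
      (2 * (X (n + p) * nextCoord i (fun q => Y (n + q)) p
          - nextCoord i (fun q => X (n + q)) p * Y (n + p))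
        + (nextCoord i (fun q => X (n + q)) p - X (n + p)) *
          neighborCoord G i (fun q => Y (n + q)) p
        - neighborCoord G i (fun q => X (n + q)) p *
          (nextCoord i (fun q => Y (n + q)) p - Y (n + p))) := by
  induction m generalizing n with
  | zero => simp [wordForm]
  | succ m ih =>
    rw [List.ofFn_succ, wordForm, Fin.sum_univ_succ, ih]
    congr 1
    · rw [letterForm, nextCoord_zero, nextCoord_zero, neighborCoord_zero, neighborCoord_zero]
      simp
    · refine Finset.sum_congr rfl fun p _ => ?_
      rw [nextCoord_succ, nextCoord_succ, neighborCoord_succ, neighborCoord_succ]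
      have (q : Fin m) : (n + 1 + (q : ℕ)) = n + (q.succ : ℕ) := by simp; ring
      simp only [this]

theorem extendZero_apply (x : Fin m → ℤ) (q : Fin m) : extendZero x q = x q := by
  simp [extendZero]

theorem extendZero_coe (x : Fin m → ℤ) : (fun q : Fin m => extendZero x q) = x := by
  funext q; simp [extendZero]

open Classical in
theorem omega_single {S : Type*} [Fintype S] [DecidableEq S] (D : Digraph S) (k l : S) :
    omega D (Pi.single k 1) (Pi.single l 1) =
      (if D.Adj k l then 1 else 0) - (if D.Adj l k then 1 else 0) := by
  rw [omega]
  simp only [LinearMap.sum_apply, wedge, LinearMap.sub_apply, LinearMap.BilinForm.linMulLin_apply,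
    LinearMap.proj_apply, Pi.single_apply]
  rw [Finset.sum_sub_distrib, Finset.sum_filter, Finset.sum_filter]
  congr 1
  · rw [Finset.sum_eq_single (k, l)]
    · simp
    · rintro ⟨a, b⟩ _ h
      have : ¬ (a = k ∧ b = l) := fun e => h (by rw [e.1, e.2])
      by_cases ha : a = k <;> by_cases hb : b = l <;> simp_all
    · simp
  · rw [Finset.sum_eq_single (l, k)]
    · simp
    · rintro ⟨a, b⟩ _ h
      have : ¬ (a = l ∧ b = k) := fun e => h (by rw [e.1, e.2])
      by_cases ha : a = l <;> by_cases hb : b = k <;> simp_all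
    · simp

end Comparison

noncomputable section Comparison

variable {P : Type*} {m : ℕ} (G : SimpleGraph P)

open Classical in
/-- For `k < l`, the value of the form of the word graph at the basis vectors at `k` and `l`. -/
theorem omega_wordGraph_single (i : Fin m → ℤˣ × P) {k l : Fin m} (hkl : k < l) :
    omega (wordGraph G i) (Pi.single k 1) (Pi.single l 1) =
      ((i k).1 : ℤ) * ((if IsHorizontal i k l then 1 else 0) -
        if IsInclined G i k l then 1 else 0) := by
  have hHI : ¬ (IsHorizontal i k l ∧ IsInclined G i k l) := by
    rintro ⟨h1, h2, _⟩
    exact h2.ne (prevIndex_eq_coe_iff.mp h1).2.1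
  rw [omega_single]
  simp only [wordGraph, hkl, hkl.asymm, true_and, false_and, or_false, false_or]
  rcases Int.units_eq_one_or (i k).1 with h | h <;> rw [h] <;>
    by_cases h1 : IsHorizontal i k l <;> by_cases h2 : IsInclined G i k l <;>
    simp_all

open Classical in
theorem sum_ite_eq_withBot (w : WithBot (Fin m)) (h : Fin m → ℤ) :
    ∑ p : Fin m, (if w = p then h p else 0) = w.recBotCoe 0 h := by
  cases w <;> simp

variable [Fintype P]

-- Among the summands of `wordForm_ofFn` only those at `k`, `k⁻` and `l⁻` can be nonzero.
open Classical in
theorem wordForm_single (i : Fin m → ℤˣ × P) {k l : Fin m} (hkl : k < l) :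
    wordForm G (List.ofFn i) 0 (extendZero (Pi.single k 1)) (extendZero (Pi.single l 1)) =
      2 * ((i k).1 * if prevIndex i l = k then 1 else 0)
      + (prevIndex i k).recBotCoe 0 (fun p => (i p).1 *
          if G.Adj (i p).2 (i l).2 ∧ prevIndex i l < p ∧ p < l then 1 else 0)
      - (i k).1 * (if G.Adj (i k).2 (i l).2 ∧ prevIndex i l < k ∧ k < l then 1 else 0)
      - (prevIndex i l).recBotCoe 0 (fun p => (i p).1 *
          if G.Adj (i p).2 (i k).2 ∧ prevIndex i k < p ∧ p < k then 1 else 0) := by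
  rw [wordForm_ofFn]
  simp only [zero_add, extendZero_coe]
  rw [← sum_ite_eq_withBot, ← sum_ite_eq_withBot]
  have e1 : ((i k).1 : ℤ) * (if prevIndex i l = k then 1 else 0) =
      ∑ p, if k = p then ((i p).1 : ℤ) * (if prevIndex i l = p then 1 else 0) else 0 := by simp
  have e2 : ((i k).1 : ℤ) * (if G.Adj (i k).2 (i l).2 ∧ prevIndex i l < k ∧ k < l then 1 else 0) =
      ∑ p, if k = p then ((i p).1 : ℤ) *
        (if G.Adj (i p).2 (i l).2 ∧ prevIndex i l < p ∧ p < l then 1 else 0) else 0 := by simp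
  rw [e1, e2, Finset.mul_sum, ← Finset.sum_add_distrib, ← Finset.sum_sub_distrib,
    ← Finset.sum_sub_distrib]
  refine Finset.sum_congr rfl fun p _ => ?_
  rw [nextCoord_single, nextCoord_single, neighborCoord_single, neighborCoord_single,
    extendZero_apply, extendZero_apply]
  by_cases hlp : l = p
  · subst hlp
    have h1 : ¬ prevIndex i k = l := fun h => (prevIndex_eq_coe_iff.mp h).1.asymm hkl
    have h2 : ¬ prevIndex i l = l := fun h => (prevIndex_eq_coe_iff.mp h).1.ne rfl
    simp [h1, h2, hkl.ne, hkl.asymm, hkl.ne']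
  · by_cases hkp : k = p
    · subst hkp
      simp only [Pi.single_eq_same, Pi.single_eq_of_ne hkl.ne, if_true]
      have h1 : ¬ prevIndex i k = k := fun h => (prevIndex_eq_coe_iff.mp h).1.ne rfl
      simp [h1]
      split_ifs <;> ring
    · simp only [Pi.single_eq_of_ne (Ne.symm hlp), Pi.single_eq_of_ne (Ne.symm hkp), if_neg hkp]
      split_ifs <;> ring

/-- At adjacent vertices the letter `k` contributes `-ε k` if `l⁻ < k`. If `k⁻ < l⁻ < k`, the letter
`l⁻` adds `-ε l⁻`; if `l⁻ < k⁻`, the letter `k⁻` adds `+ε k⁻`. The sum is `-2 ε k` or `0` exactly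
according to the sign conditions defining inclined edges. -/
theorem two_mul_omega_single (i : Fin m → ℤˣ × P) {k l : Fin m} (hkl : k < l)
    (hB : k ∈ boundedIndices i ∨ l ∈ boundedIndices i) :
    2 * omega (wordGraph G i) (Pi.single k 1) (Pi.single l 1) =
      wordForm G (List.ofFn i) 0 (extendZero (Pi.single k 1)) (extendZero (Pi.single l 1)) := by
  classical
  rw [omega_wordGraph_single G i hkl, wordForm_single G i hkl, IsHorizontal, IsInclined]
  simp only [boundedIndices, Set.mem_ofPred_eq] at hB
  have hk (p : Fin m) (hp : prevIndex i k = p) : p < k ∧ (i p).2 = (i k).2 :=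
    ⟨(prevIndex_eq_coe_iff.mp hp).1, (prevIndex_eq_coe_iff.mp hp).2.1⟩
  have hl (p : Fin m) (hp : prevIndex i l = p) : p < l ∧ (i p).2 = (i l).2 :=
    ⟨(prevIndex_eq_coe_iff.mp hp).1, (prevIndex_eq_coe_iff.mp hp).2.1⟩
  generalize prevIndex i k = a at *
  generalize prevIndex i l = b at *
  cases a with
  | bot =>
    cases b with
    -- The excluded case is the one where the identity can fail: at adjacent vertices only the odd
    -- term of `k` survives.
    | bot => simp at hB
    | coe q =>
      obtain ⟨hq, hq'⟩ := hl q rfl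
      by_cases hadj : G.Adj (i k).2 (i l).2
      · have hqk : q ≠ k := by rintro rfl; exact hadj.ne hq'
        simp [hq', hadj, hadj.symm, hqk, hkl]
        rcases Int.units_eq_one_or (i k).1 with h | h <;>
          rcases Int.units_eq_one_or (i q).1 with h' | h' <;> simp [h, h'] <;> split_ifs <;> simp_all
      · have hadj' : ¬ G.Adj (i l).2 (i k).2 := fun e => hadj e.symm
        simp [hq', hadj, hadj']
  | coe p =>
    obtain ⟨hp, hp'⟩ := hk p rfl
    cases b with
    | bot =>
      by_cases hadj : G.Adj (i k).2 (i l).2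
      · have hpl := hp.trans hkl
        simp [hp', hadj, hkl, hpl]
        rcases Int.units_eq_one_or (i k).1 with h | h <;>
          rcases Int.units_eq_one_or (i p).1 with h' | h' <;> simp [h, h', hp]
      · simp [hp', hadj]
    | coe q =>
      obtain ⟨hq, hq'⟩ := hl q rfl
      by_cases hadj : G.Adj (i k).2 (i l).2
      · have hqk : q ≠ k := by rintro rfl; exact hadj.ne hq'
        have hpq : p ≠ q := by rintro rfl; exact hadj.ne (hp'.symm.trans hq')
        have hpl := hp.trans hkl
        simp [hp', hq', hadj, hadj.symm, hqk, hkl, hpl]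
        rcases lt_or_gt_of_ne hpq with hlt | hlt
        · rcases Int.units_eq_one_or (i k).1 with h | h <;>
            rcases Int.units_eq_one_or (i q).1 with h' | h' <;>
            simp [h, h', hlt, hlt.asymm] <;> split_ifs <;> simp_all
        · have hqk' := hlt.trans hp
          rcases Int.units_eq_one_or (i k).1 with h | h <;>
            rcases Int.units_eq_one_or (i p).1 with h' | h' <;>
            simp [h, h', hlt, hlt.asymm, hp, hqk']
      · have hadj' : ¬ G.Adj (i l).2 (i k).2 := fun e => hadj e.symm
        simp [hp', hq', hadj, hadj']

theorem wordForm_add_left (w : List (ℤˣ × P)) (n : ℕ) (X X' Y : ℕ → ℤ) :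
    wordForm G w n (X + X') Y = wordForm G w n X Y + wordForm G w n X' Y := by
  rw [wordForm_swap, wordForm_add_right, wordForm_swap G w n Y X, wordForm_swap G w n Y X']
  ring

theorem extendZero_add (x y : Fin m → ℤ) : extendZero (x + y) = extendZero x + extendZero y := by
  funext n
  by_cases h : n < m <;> simp [extendZero, h]

theorem omega_swap {S : Type*} [Fintype S] (D : Digraph S) (x y : S → ℤ) :
    omega D y x = - omega D x y := by
  have h := omega_self D (x + y)
  simp only [map_add, LinearMap.add_apply, omega_self] at h
  omega

/-- At a bounded index, the form of a word is twice the form of its graph. -/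
theorem two_mul_omega (i : Fin m → ℤˣ × P) (x : Fin m → ℤ) {k : Fin m}
    (hk : k ∈ boundedIndices i) :
    2 * omega (wordGraph G i) x (Pi.single k 1) =
      wordForm G (List.ofFn i) 0 (extendZero x) (extendZero (Pi.single k 1)) := by
  let f : (Fin m → ℤ) →+ ℤ := AddMonoidHom.mk'
    (fun x => wordForm G (List.ofFn i) 0 (extendZero x) (extendZero (Pi.single k 1)))
    fun x y => by rw [extendZero_add, wordForm_add_left]
  suffices h : (2 : ℤ) • (omega (wordGraph G i)).flip (Pi.single k 1) = f.toIntLinearMap from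
    LinearMap.congr_fun h x
  refine LinearMap.pi_ext' fun l => LinearMap.ext_ring ?_
  change 2 * omega (wordGraph G i) (Pi.single l 1) (Pi.single k 1) =
    wordForm G (List.ofFn i) 0 (extendZero (Pi.single l 1)) (extendZero (Pi.single k 1))
  rcases lt_trichotomy l k with h | rfl | h
  · exact two_mul_omega_single G i h (.inr hk)
  · have := wordForm_swap G (List.ofFn i) 0 (extendZero (Pi.single l 1)) (extendZero (Pi.single l 1))
    rw [omega_self]
    omega
  · rw [omega_swap, wordForm_swap, ← two_mul_omega_single G i h (.inl hk)]
    ring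

end Comparison

/-! ### Conjugation of groups generated by transvections -/

noncomputable section Conjugation

variable {S : Type*} [Fintype S] (D : Digraph S)

/-- The symplectic transvection `x ↦ x - Ω (x, v) v` along a vector `v`. -/
def transvection (v : S → ℤ) : LinearMap.GeneralLinearGroup ℤ (S → ℤ) :=
  LinearMap.GeneralLinearGroup.ofLinearEquiv
    { toFun := fun x => x - omega D x v • v
      invFun := fun x => x + omega D x v • v
      map_add' := fun x y => by
        simp only [map_add, LinearMap.add_apply, add_smul]; abel
      map_smul' := fun r x => by
        simp only [map_smul, LinearMap.smul_apply, smul_eq_mul, mul_smul, RingHom.id_apply,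
          smul_sub]
      left_inv := fun x => by
        simp only [map_sub, map_smul, LinearMap.sub_apply, LinearMap.smul_apply, omega_self,
          smul_zero, sub_zero, sub_add_cancel]
      right_inv := fun x => by
        simp only [map_add, map_smul, LinearMap.add_apply, LinearMap.smul_apply, omega_self,
          smul_zero, add_zero, add_sub_cancel_right] }

theorem transvection_single [DecidableEq S] (k : S) :
    transvection D (Pi.single k 1) = tau D k := rfl

theorem transvection_apply (v x : S → ℤ) :
    (transvection D v : (S → ℤ) →ₗ[ℤ] (S → ℤ)) x = x - omega D x v • v := rfl

theorem transvection_neg (v : S → ℤ) : transvection D (-v) = transvection D v := by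
  refine Units.ext (LinearMap.ext fun x => ?_)
  simp [transvection_apply]

/-- Here `u + v` is the image of `u` under the transvection along `v`, and conjugating a
transvection moves its vector. For the opposite sign of the form, `u` is the image of `u + v`. -/
theorem transvection_add_mul {u v : S → ℤ} (h : omega D u v = -1) :
    transvection D (u + v) * transvection D v = transvection D v * transvection D u := by
  refine Units.ext (LinearMap.ext fun x => ?_)
  have h' : omega D v u = 1 := by rw [omega_swap, h]; rfl
  simp only [Units.val_mul, Module.End.mul_apply, transvection_apply, map_sub, map_add, map_smul,
    omega_self, h, h']
  module

theorem mul_transvection_add {u v : S → ℤ} (h : omega D u v = 1) :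
    transvection D v * transvection D (u + v) = transvection D u * transvection D v := by
  refine Units.ext (LinearMap.ext fun x => ?_)
  have h' : omega D v u = -1 := by rw [omega_swap, h]
  simp only [Units.val_mul, Module.End.mul_apply, transvection_apply, map_sub, map_add, map_smul,
    omega_self, h, h']
  module

/-- In a subgroup containing the transvection along `v`, the transvections along `u` and `u + v`
occur together if `Ω (u, v) = ± 1`. -/
theorem transvection_add_mem_iff {H : Subgroup (LinearMap.GeneralLinearGroup ℤ (S → ℤ))}
    {u v : S → ℤ} (hv : transvection D v ∈ H) (h : omega D u v = 1 ∨ omega D u v = -1) :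
    transvection D (u + v) ∈ H ↔ transvection D u ∈ H := by
  rcases h with h | h
  · rw [← H.mul_mem_cancel_left hv, mul_transvection_add D h, H.mul_mem_cancel_right hv]
  · rw [← H.mul_mem_cancel_right hv, transvection_add_mul D h, H.mul_mem_cancel_left hv]

/-- The forms need to match only against `v`. So `g` may fail to be an isometry for `omega` on
unbounded pairs, where `omega` and `wordForm` can differ. -/
theorem conj_transvection {D D' : Digraph S} (g : (S → ℤ) ≃ₗ[ℤ] (S → ℤ)) {v : S → ℤ}
    (h : ∀ x, omega D x v = omega D' (g x) (g v)) :
    MulAut.conj (LinearMap.GeneralLinearGroup.ofLinearEquiv g) (transvection D v) =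
      transvection D' (g v) := by
  rw [MulAut.conj_apply, mul_inv_eq_iff_eq_mul]
  refine Units.ext (LinearMap.ext fun x => ?_)
  simp only [Units.val_mul, Module.End.mul_apply]
  change g (x - omega D x v • v) = g x - omega D' (g x) (g v) • g v
  rw [map_sub, map_smul, h]

/-- A criterion for a linear map to conjugate the group of `D` to the group of `D'`: up to a
relabelling and signs, it maps basis vectors to basis vectors or to their images under other
transvections of the group. -/
theorem transvectionGroup_eq_map_conj [DecidableEq S] {D D' : Digraph S} {B B' : Set S}
    (g : (S → ℤ) ≃ₗ[ℤ] (S → ℤ)) (σ : Equiv.Perm S) (hσ : ∀ k, σ k ∈ B' ↔ k ∈ B)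
    (hform : ∀ k ∈ B, ∀ x, omega D x (Pi.single k 1) = omega D' (g x) (g (Pi.single k 1)))
    (hg : ∀ k ∈ B, g (Pi.single k 1) = Pi.single (σ k) 1 ∨
      g (Pi.single k 1) = -Pi.single (σ k) 1 ∨
      ∃ b ∈ B, g (Pi.single b 1) = -Pi.single (σ b) 1 ∧
        g (Pi.single k 1) = Pi.single (σ k) 1 + Pi.single (σ b) 1 ∧
        (omega D' (Pi.single (σ k) 1) (Pi.single (σ b) 1) = 1 ∨
          omega D' (Pi.single (σ k) 1) (Pi.single (σ b) 1) = -1)) :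
    transvectionGroup D' B' = (transvectionGroup D B).map
      (MulAut.conj (LinearMap.GeneralLinearGroup.ofLinearEquiv g)).toMonoidHom := by
  have himage : (transvectionGroup D B).map
      (MulAut.conj (LinearMap.GeneralLinearGroup.ofLinearEquiv g)).toMonoidHom =
      Subgroup.closure ((fun k => transvection D' (g (Pi.single k 1))) '' B) := by
    rw [transvectionGroup, MonoidHom.map_closure, Set.image_image]
    congr 1
    refine Set.image_congr fun k hk => ?_
    exact conj_transvection g (hform k hk)
  have hB' : transvectionGroup D' B' =
      Subgroup.closure ((fun k => transvection D' (Pi.single (σ k) 1)) '' B) := by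
    rw [transvectionGroup]
    congr 1
    ext t
    constructor
    · rintro ⟨k, hk, rfl⟩
      exact ⟨σ.symm k, (hσ _).mp (by simpa using hk), by simp [transvection_single]⟩
    · rintro ⟨k, hk, rfl⟩
      exact ⟨σ k, (hσ k).mpr hk, rfl⟩
  rw [himage, hB']
  refine le_antisymm ((Subgroup.closure_le _).mpr ?_) ((Subgroup.closure_le _).mpr ?_)
  · rintro _ ⟨k, hk, rfl⟩
    have mem (j) (hj : j ∈ B) := Subgroup.subset_closure (Set.mem_image_of_mem
      (fun k => transvection D' (g (Pi.single k 1))) hj)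
    have hmem := mem k hk
    rcases hg k hk with h | h | ⟨b, hb, h1, h2, h3⟩
    · simpa only [h] using hmem
    · simpa only [h, transvection_neg] using hmem
    -- Opposite vectors have the same transvection, so the image of `e b` already puts the one along
    -- `e (σ b)` into the group; it then strips `e (σ b)` from the image of `e k`.
    · have hbm := mem b hb
      simp only [h1, h2, transvection_neg] at hmem hbm
      exact (transvection_add_mem_iff D' hbm h3).mp hmem
  · rintro _ ⟨k, hk, rfl⟩
    have mem (j) (hj : j ∈ B) := Subgroup.subset_closure (Set.mem_image_of_mem
      (fun k => transvection D' (Pi.single (σ k) 1)) hj)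
    have hmem := mem k hk
    rw [SetLike.mem_coe] at hmem ⊢
    rcases hg k hk with h | h | ⟨b, hb, h1, h2, h3⟩
    · simpa only [h] using hmem
    · simpa only [h, transvection_neg] using hmem
    · simp only [h2]
      exact (transvection_add_mem_iff D' (mem b hb) h3).mpr hmem

end Conjugation

/-! ### Invariance of the group of a word under moves -/

noncomputable section Moves

variable {P : Type*} {m : ℕ}

theorem extendZero_smul (r : ℤ) (x : Fin m → ℤ) : extendZero (r • x) = r • extendZero x := by
  funext n
  by_cases h : n < m <;> simp [extendZero, h]

theorem extendZero_single (k : Fin m) :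
    extendZero (Pi.single k 1) = Pi.single (k : ℕ) 1 := by
  funext n
  by_cases h : n < m
  · simp [extendZero, h, Pi.single_apply, Fin.ext_iff]
  · have : n ≠ k := by omega
    simp [extendZero, h, this]

theorem extendZero_of_lt (x : Fin m → ℤ) {n : ℕ} (h : n < m) : extendZero x n = x ⟨n, h⟩ := by
  simp [extendZero, h]

theorem extendZero_congr {x y : Fin m → ℤ} {n : ℕ} (h : ∀ hn : n < m, x ⟨n, hn⟩ = y ⟨n, hn⟩) :
    extendZero x n = extendZero y n := by
  by_cases hn : n < m
  · simp [extendZero, hn, h hn]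
  · simp [extendZero, hn]

/-- The reflection that replaces the coordinate `x b` by `f x - x b`. -/
def coordReflection {S : Type*} [DecidableEq S] (b : S) (f : (S → ℤ) →ₗ[ℤ] ℤ)
    (hf : f (Pi.single b 1) = 0) : (S → ℤ) ≃ₗ[ℤ] (S → ℤ) :=
  LinearEquiv.ofInvolutive
    (LinearMap.id + (f - (2 : ℤ) • LinearMap.proj b).smulRight (Pi.single b (1 : ℤ))) fun x => by
      ext k
      simp only [LinearMap.add_apply, LinearMap.id_apply, LinearMap.smulRight_apply,
        LinearMap.sub_apply, LinearMap.smul_apply, LinearMap.proj_apply, map_add, map_smul, hf,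
        Pi.add_apply, Pi.smul_apply, Pi.single_eq_same, smul_eq_mul]
      ring

theorem coordReflection_apply {S : Type*} [DecidableEq S] (b : S) (f : (S → ℤ) →ₗ[ℤ] ℤ)
    (hf : f (Pi.single b 1) = 0) (x : S → ℤ) :
    coordReflection b f hf x = x + (f x - 2 * x b) • Pi.single b 1 := by
  simp [coordReflection, LinearEquiv.ofInvolutive]

theorem coordReflection_apply_self {S : Type*} [DecidableEq S] (b : S) (f : (S → ℤ) →ₗ[ℤ] ℤ)
    (hf : f (Pi.single b 1) = 0) (x : S → ℤ) :
    coordReflection b f hf x b = f x - x b := by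
  simp [coordReflection_apply]; ring

theorem coordReflection_apply_of_ne {S : Type*} [DecidableEq S] (b : S) (f : (S → ℤ) →ₗ[ℤ] ℤ)
    (hf : f (Pi.single b 1) = 0) (x : S → ℤ) {k : S} (hk : k ≠ b) :
    coordReflection b f hf x k = x k := by
  simp [coordReflection_apply, hk]

theorem funCongrLeft_swap_single {S : Type*} [DecidableEq S] (p q k : S) :
    LinearEquiv.funCongrLeft ℤ ℤ (Equiv.swap p q) (Pi.single k 1) =
      Pi.single (Equiv.swap p q k) 1 := by
  funext l
  rw [LinearEquiv.funCongrLeft_apply, LinearMap.funLeft_apply, Pi.single_apply, Pi.single_apply]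
  exact if_congr (Equiv.swap_apply_eq_iff) rfl rfl

/-- The sum of the coordinate at `a` and the coordinate of the first letter at a vertex. -/
def coordAddFirst (a : Fin m) (w : List (ℤˣ × P)) (n : ℕ) (j : P) : (Fin m → ℤ) →ₗ[ℤ] ℤ where
  toFun x := x a + firstCoord w n (extendZero x) j
  map_add' x y := by simp only [extendZero_add, firstCoord_add, Pi.add_apply]; ring
  map_smul' r x := by
    simp only [extendZero_smul, firstCoord_smul, Pi.smul_apply, smul_eq_mul, RingHom.id_apply]; ring

theorem coordAddFirst_apply (a : Fin m) (w : List (ℤˣ × P)) (n : ℕ) (j : P) (x : Fin m → ℤ) :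
    coordAddFirst a w n j x = x a + firstCoord w n (extendZero x) j := rfl

variable [Fintype P] (G : SimpleGraph P)

theorem wordForm_neg_right (w : List (ℤˣ × P)) (n : ℕ) (X Y : ℕ → ℤ) :
    wordForm G w n X (-Y) = - wordForm G w n X Y := by
  have := wordForm_add_right G w n X Y (-Y)
  rw [add_neg_cancel, wordForm_zero_right] at this
  omega

theorem extendZero_neg (x : Fin m → ℤ) : extendZero (-x) = -extendZero x := by
  funext n
  by_cases h : n < m <;> simp [extendZero, h]

/-- A criterion for the groups of two words to be conjugate, in terms of the forms of the words. -/
theorem wordGroup_eq_map_conj {i i' : Fin m → ℤˣ × P} (g : (Fin m → ℤ) ≃ₗ[ℤ] (Fin m → ℤ))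
    (σ : Equiv.Perm (Fin m)) (hσ : ∀ k, σ k ∈ boundedIndices i' ↔ k ∈ boundedIndices i)
    (hform : ∀ x y, wordForm G (List.ofFn i') 0 (extendZero (g x)) (extendZero (g y)) =
      wordForm G (List.ofFn i) 0 (extendZero x) (extendZero y))
    (hg : ∀ k ∈ boundedIndices i, g (Pi.single k 1) = Pi.single (σ k) 1 ∨
      g (Pi.single k 1) = -Pi.single (σ k) 1 ∨
      ∃ b ∈ boundedIndices i, g (Pi.single b 1) = -Pi.single (σ b) 1 ∧
        g (Pi.single k 1) = Pi.single (σ k) 1 + Pi.single (σ b) 1 ∧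
        ∃ e : ℤˣ, wordForm G (List.ofFn i') 0 (Pi.single (σ k : ℕ) 1) (Pi.single (σ b : ℕ) 1) =
          2 * e) :
    ∃ g : LinearMap.GeneralLinearGroup ℤ (Fin m → ℤ),
      wordGroup G i' = (wordGroup G i).map (MulAut.conj g).toMonoidHom := by
  refine ⟨_, transvectionGroup_eq_map_conj g σ hσ (fun k hk x => ?_) fun k hk => ?_⟩
  · have h0 := two_mul_omega G i x hk
    have h1 := two_mul_omega G i' (g x) ((hσ k).mpr hk)
    rw [← hform] at h0
    -- In all three cases `g` sends `e k` to a combination of bounded basis vectors, so the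
    -- comparison with the word form extends to it by linearity, and the factor 2 cancels.
    suffices h : 2 * omega (wordGraph G i') (g x) (g (Pi.single k 1)) =
        wordForm G (List.ofFn i') 0 (extendZero (g x)) (extendZero (g (Pi.single k 1))) by omega
    rcases hg k hk with h | h | ⟨b, hb, -, h, -⟩
    · rw [h, h1]
    · rw [h, map_neg, extendZero_neg, wordForm_neg_right, ← h1]; ring
    · have h2 := two_mul_omega G i' (g x) ((hσ b).mpr hb)
      rw [h, map_add, extendZero_add, wordForm_add_right, ← h1, ← h2]; ring
  · refine (hg k hk).imp_right (Or.imp_right ?_)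
    rintro ⟨b, hb, h1, h2, e, h3⟩
    refine ⟨b, hb, h1, h2, ?_⟩
    have := two_mul_omega G i' (Pi.single (σ k) 1) ((hσ b).mpr hb)
    rw [extendZero_single, extendZero_single, h3] at this
    rcases Int.units_eq_one_or e with rfl | rfl
    · left; push_cast at this; omega
    · right; push_cast at this; omega

/-- The criterion for a swap of two indices followed by a reflection of a coordinate `b`. -/
theorem wordGroup_eq_map_conj_of_reflection {i i' : Fin m → ℤˣ × P} (p q b : Fin m)
    (f : (Fin m → ℤ) →ₗ[ℤ] ℤ) (hf : f (Pi.single b 1) = 0) (hb : Equiv.swap p q b = b)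
    (hbb : b ∈ boundedIndices i)
    (hσ : ∀ k, Equiv.swap p q k ∈ boundedIndices i' ↔ k ∈ boundedIndices i)
    (hform : ∀ x y : Fin m → ℤ, wordForm G (List.ofFn i') 0
        (extendZero (coordReflection b f hf fun k => x (Equiv.swap p q k)))
        (extendZero (coordReflection b f hf fun k => y (Equiv.swap p q k))) =
      wordForm G (List.ofFn i) 0 (extendZero x) (extendZero y))
    (hfg : ∀ k, f (Pi.single k 1) = 0 ∨ f (Pi.single k 1) = 1 ∧
      ∃ e : ℤˣ, wordForm G (List.ofFn i') 0 (Pi.single (k : ℕ) 1) (Pi.single (b : ℕ) 1) =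
          2 * e) :
    ∃ g : LinearMap.GeneralLinearGroup ℤ (Fin m → ℤ),
      wordGroup G i' = (wordGroup G i).map (MulAut.conj g).toMonoidHom := by
  have hgb : (coordReflection b f hf) (Pi.single b 1) = -Pi.single b 1 := by
    rw [coordReflection_apply, hf]
    ext k; simp; ring
  refine wordGroup_eq_map_conj G
    ((LinearEquiv.funCongrLeft ℤ ℤ (Equiv.swap p q)).trans (coordReflection b f hf))
    (Equiv.swap p q) hσ hform fun k hk => ?_
  simp only [LinearEquiv.trans_apply, funCongrLeft_swap_single]
  by_cases hkb : Equiv.swap p q k = b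
  · rw [hkb]
    exact .inr (.inl hgb)
  · have hgk : (coordReflection b f hf) (Pi.single (Equiv.swap p q k) 1) =
        Pi.single (Equiv.swap p q k) 1 + f (Pi.single (Equiv.swap p q k) 1) • Pi.single b 1 := by
      rw [coordReflection_apply, Pi.single_eq_of_ne (Ne.symm hkb)]
      simp
    rcases hfg (Equiv.swap p q k) with h | ⟨h, he⟩
    · exact .inl (by rw [hgk, h, zero_smul, add_zero])
    · refine .inr (.inr ⟨b, hbb, by rw [hb, hgb], by rw [hgk, h, hb, one_smul], ?_⟩)
      rw [hb]; exact he

end Moves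

/-! ### Conjugating maps for the individual moves. -/

noncomputable section Moves

variable {P : Type*} {m : ℕ}

theorem getElem?_of_ofFn_eq {i : Fin m → ℤˣ × P} {w : List (ℤˣ × P)} (h : List.ofFn i = w)
    (k : Fin m) : w[(k : ℕ)]? = some (i k) := by
  rw [← h, List.getElem?_ofFn]; simp

theorem getElem?_append_cons_cons (pre post : List (ℤˣ × P)) (a b a' b' : ℤˣ × P) {q : ℕ}
    (h : q ≠ pre.length) (h' : q ≠ pre.length + 1) :
    (pre ++ a :: b :: post)[q]? = (pre ++ a' :: b' :: post)[q]? := by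
  rcases lt_or_ge q pre.length with hq | hq
  · rw [List.getElem?_append_left hq, List.getElem?_append_left hq]
  · obtain ⟨r, rfl⟩ := Nat.exists_eq_add_of_le hq
    obtain _ | _ | r := r
    · omega
    · omega
    · simp [List.getElem?_append_right]

theorem getElem?_append_cons_cons_cons (pre post : List (ℤˣ × P)) (a b c a' b' c' : ℤˣ × P) {q : ℕ}
    (h : q < pre.length ∨ pre.length + 3 ≤ q) :
    (pre ++ a :: b :: c :: post)[q]? = (pre ++ a' :: b' :: c' :: post)[q]? := by
  rcases lt_or_ge q pre.length with hq | hq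
  · rw [List.getElem?_append_left hq, List.getElem?_append_left hq]
  · obtain ⟨r, rfl⟩ := Nat.exists_eq_add_of_le hq
    obtain _ | _ | _ | r := r
    · omega
    · omega
    · omega
    · simp [List.getElem?_append_right]

/-- Since one letter is first at no more than one vertex, at most one term of the pairing formulas
survives on a basis vector beyond the moved letters. -/
theorem firstCoord_single_eq_one {w : List (ℤˣ × P)} {n k : ℕ} {j : P}
    (h : firstCoord w n (Pi.single k 1) j ≠ 0) :
    n ≤ k ∧ ∀ l, firstCoord w n (Pi.single k 1) l = Set.indicator {j} 1 l := by
  classical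
  constructor
  · by_contra hk
    rw [firstCoord_eq_zero w n fun q hq => Pi.single_eq_of_ne (by omega) _] at h
    exact h rfl
  · rcases firstCoord_single w n k with h0 | ⟨j', h0⟩
    · rw [h0] at h; exact absurd rfl h
    · rw [h0] at h ⊢
      have : j = j' := by
        by_contra hne
        exact h (Pi.single_eq_of_ne hne _)
      subst this
      intro l
      by_cases hl : l = j
      · subst hl; simp
      · simp [hl]

variable (G : SimpleGraph P)

/-- The relation between signed words that have the same length and conjugate groups. -/
def ConjugateWords (w w' : List (ℤˣ × P)) : Prop :=
  w.length = w'.length ∧ ∀ (m : ℕ) (i i' : Fin m → ℤˣ × P), List.ofFn i = w → List.ofFn i' = w' →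
    ∃ g : LinearMap.GeneralLinearGroup ℤ (Fin m → ℤ),
      wordGroup G i' = (wordGroup G i).map (MulAut.conj g).toMonoidHom

theorem conjugateWords_equivalence : Equivalence (ConjugateWords G) where
  refl w := by
    refine ⟨rfl, fun m i i' h h' => ⟨1, ?_⟩⟩
    obtain rfl : i = i' := List.ofFn_injective (h.trans h'.symm)
    rw [map_one]
    exact (Subgroup.map_id _).symm
  symm := by
    rintro w w' ⟨hl, h⟩
    refine ⟨hl.symm, fun m i i' hi hi' => ?_⟩
    obtain ⟨g, hg⟩ := h m i' i hi' hi
    refine ⟨g⁻¹, ?_⟩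
    rw [hg, Subgroup.map_map]
    convert (Subgroup.map_id _).symm
    ext x
    simp [mul_assoc]
  trans := by
    rintro w w' w'' ⟨hl, h⟩ ⟨hl', h'⟩
    refine ⟨hl.trans hl', fun m i i'' hi hi'' => ?_⟩
    -- Equality of lengths lets the intermediate word be indexed by the same `Fin m`.
    have hm : w'.length = m := by rw [← hl, ← hi, List.length_ofFn]
    subst hm
    obtain ⟨g, hg⟩ := h _ i w'.get hi (List.ofFn_get w')
    obtain ⟨g', hg'⟩ := h' _ w'.get i'' (List.ofFn_get w') hi''
    refine ⟨g' * g, ?_⟩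
    rw [hg', hg, Subgroup.map_map]
    congr 1

variable [Fintype P]

theorem conjugateWords_swap_letters (pre post : List (ℤˣ × P)) {a b : ℤˣ × P} (hab : a.2 ≠ b.2)
    (h : b.1 = -a.1 ∨ ¬ G.Adj a.2 b.2) :
    ConjugateWords G (pre ++ a :: b :: post) (pre ++ b :: a :: post) := by
  refine ⟨by simp, fun m i i' hi hi' => ?_⟩
  have hm : pre.length + (post.length + 2) = m := by
    simpa using (congrArg List.length hi).symm
  let p : Fin m := ⟨pre.length, by omega⟩
  let q : Fin m := ⟨pre.length + 1, by omega⟩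
  have hip : i p = a := by simpa [p] using (getElem?_of_ofFn_eq hi p).symm
  have hiq : i q = b := by simpa [q] using (getElem?_of_ofFn_eq hi q).symm
  have hip' : i' p = b := by simpa [p] using (getElem?_of_ofFn_eq hi' p).symm
  have hiq' : i' q = a := by simpa [q] using (getElem?_of_ofFn_eq hi' q).symm
  have hne (k : Fin m) (hkp : k ≠ p) (hkq : k ≠ q) : i' k = i k := by
    have h1 := getElem?_of_ofFn_eq hi k
    have h2 := getElem?_of_ofFn_eq hi' k
    rw [getElem?_append_cons_cons pre post a b b a (fun e => hkp (Fin.ext e))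
      (fun e => hkq (Fin.ext e)), h2] at h1
    exact Option.some_injective _ h1
  have hσ' (k : Fin m) : i' (Equiv.swap p q k) = i k := by
    rw [Equiv.swap_apply_def]
    split_ifs with h1 h2
    · rw [h1, hiq', hip]
    · rw [h2, hip', hiq]
    · exact hne k h1 h2
  -- The swap reverses only the order of `p` and `q`, which lie at different vertices, so the order
  -- within each vertex and hence boundedness are preserved.
  have hlt (r k : Fin m) (hrk : (i r).2 = (i k).2) :
      Equiv.swap p q r < Equiv.swap p q k ↔ r < k := by
    have h1 : ¬ (r = p ∧ k = q) := by rintro ⟨rfl, rfl⟩; rw [hip, hiq] at hrk; exact hab hrk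
    have h2 : ¬ (r = q ∧ k = p) := by rintro ⟨rfl, rfl⟩; rw [hip, hiq] at hrk; exact hab hrk.symm
    simp only [Equiv.swap_apply_def]
    simp only [Fin.ext_iff, p, q] at h1 h2 ⊢
    split_ifs <;> simp only [Fin.lt_def] <;> omega
  refine wordGroup_eq_map_conj G (LinearEquiv.funCongrLeft ℤ ℤ (Equiv.swap p q)) (Equiv.swap p q)
    (fun k => ?_) (fun x y => ?_) fun k hk => .inl (funCongrLeft_swap_single p q k)
  · rw [mem_boundedIndices_iff, mem_boundedIndices_iff, (Equiv.swap p q).surjective.exists]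
    refine exists_congr fun r => ?_
    rw [hσ', hσ']
    exact and_congr_left fun hrk => hlt r k hrk
  · have e0 (x : Fin m → ℤ) : extendZero (LinearEquiv.funCongrLeft ℤ ℤ (Equiv.swap p q) x)
        pre.length = extendZero x (pre.length + 1) := by
      rw [extendZero_of_lt _ p.2, extendZero_of_lt _ q.2]
      exact congrArg x (Equiv.swap_apply_left p q)
    have e1 (x : Fin m → ℤ) : extendZero (LinearEquiv.funCongrLeft ℤ ℤ (Equiv.swap p q) x)
        (pre.length + 1) = extendZero x pre.length := by
      rw [extendZero_of_lt _ p.2, extendZero_of_lt _ q.2]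
      exact congrArg x (Equiv.swap_apply_right p q)
    have e2 (x : Fin m → ℤ) (n : ℕ) (hn : n < pre.length ∨ pre.length + 2 ≤ n) :
        extendZero (LinearEquiv.funCongrLeft ℤ ℤ (Equiv.swap p q) x) n = extendZero x n :=
      extendZero_congr fun hn' => congrArg x (Equiv.swap_apply_of_ne_of_ne
        (fun e => by have := congrArg Fin.val e; simp only [p] at this; omega)
        (fun e => by have := congrArg Fin.val e; simp only [q] at this; omega))
    rw [hi, hi']
    exact wordForm_swap_letters G pre post hab h (e0 x) (e1 x) (e2 x) (e0 y) (e1 y) (e2 y)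

theorem conjugateWords_swap_sign (pre post : List (ℤˣ × P)) (e : ℤˣ) (j : P) :
    ConjugateWords G (pre ++ (e, j) :: (-e, j) :: post) (pre ++ (-e, j) :: (e, j) :: post) := by
  refine ⟨by simp, fun m i i' hi hi' => ?_⟩
  have hm : pre.length + (post.length + 2) = m := by
    simpa using (congrArg List.length hi).symm
  let p : Fin m := ⟨pre.length, by omega⟩
  let q : Fin m := ⟨pre.length + 1, by omega⟩
  have hpq : p < q := Fin.lt_def.mpr (by simp [p, q])
  have hip : i p = (e, j) := by simpa [p] using (getElem?_of_ofFn_eq hi p).symm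
  have hiq : i q = (-e, j) := by simpa [q] using (getElem?_of_ofFn_eq hi q).symm
  have hip' : i' p = (-e, j) := by simpa [p] using (getElem?_of_ofFn_eq hi' p).symm
  have hiq' : i' q = (e, j) := by simpa [q] using (getElem?_of_ofFn_eq hi' q).symm
  have hlevel (k : Fin m) : (i' k).2 = (i k).2 := by
    by_cases hkp : k = p
    · rw [hkp, hip, hip']
    by_cases hkq : k = q
    · rw [hkq, hiq, hiq']
    have h1 := getElem?_of_ofFn_eq hi k
    have h2 := getElem?_of_ofFn_eq hi' k
    rw [getElem?_append_cons_cons pre post _ _ (-e, j) (e, j) (fun e => hkp (Fin.ext e))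
      (fun e => hkq (Fin.ext e)), h2] at h1
    rw [Option.some_injective _ h1]
  have hfirst (k : Fin m) (hk : (k : ℕ) < pre.length + 2) :
      firstCoord post (pre.length + 2) (Pi.single (k : ℕ) 1) = 0 :=
    firstCoord_eq_zero post _ fun n hn => Pi.single_eq_of_ne (by omega) _
  have hf : coordAddFirst p post (pre.length + 2) j (Pi.single q 1) = 0 := by
    rw [coordAddFirst_apply, extendZero_single, hfirst q (by simp [q]), Pi.single_eq_of_ne hpq.ne]
    rfl
  -- No relabelling is needed: `swap p p` is the identity, and only the coordinate of the second
  -- letter is reflected.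
  refine wordGroup_eq_map_conj_of_reflection G p p q _ hf (by simp) ?_ (fun k => ?_) (fun x y => ?_)
    fun k => ?_
  · exact mem_boundedIndices_iff.mpr ⟨p, hpq, by rw [hip, hiq]⟩
  · simp only [Equiv.swap_self, Equiv.refl_apply, mem_boundedIndices_iff, hlevel]
  · simp only [Equiv.swap_self, Equiv.refl_apply]
    have e1 (x : Fin m → ℤ) : extendZero (coordReflection q _ hf x) (pre.length + 1) =
        extendZero x pre.length + firstCoord post (pre.length + 2) (extendZero x) j
          - extendZero x (pre.length + 1) := by
      rw [extendZero_of_lt _ p.2, extendZero_of_lt _ q.2, extendZero_of_lt _ q.2]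
      exact coordReflection_apply_self q _ hf x
    have e2 (x : Fin m → ℤ) (n : ℕ) (hn : n ≠ pre.length + 1) :
        extendZero (coordReflection q _ hf x) n = extendZero x n :=
      extendZero_congr fun hn' => coordReflection_apply_of_ne q _ hf x
        fun e => hn (by simpa [q] using congrArg Fin.val e)
    rw [hi, hi']
    exact wordForm_swap_sign G pre post e j (e1 x) (e2 x) (e1 y) (e2 y)
  · have hform := wordForm_single_of_swap_sign G pre post (-e) j (Pi.single (k : ℕ) 1)
    rw [neg_neg] at hform
    simp only [hi', q]
    rw [hform, coordAddFirst_apply, extendZero_single]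
    by_cases hk : k = p
    · subst hk
      rw [hfirst p (by simp [p]), neighborSum_zero]
      refine .inr ⟨by simp, -e, by simp [p]⟩
    · have hk' : (k : ℕ) ≠ pre.length := fun e => hk (Fin.ext e)
      rw [Pi.single_eq_of_ne (Ne.symm hk), Pi.single_eq_of_ne hk'.symm, zero_add]
      by_cases h0 : firstCoord post (pre.length + 2) (Pi.single (k : ℕ) 1) j = 0
      · exact .inl h0
      · obtain ⟨-, h1⟩ := firstCoord_single_eq_one h0
        have h2 : neighborSum G (firstCoord post (pre.length + 2) (Pi.single (k : ℕ) 1)) j = 0 := by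
          classical
          have : firstCoord post (pre.length + 2) (Pi.single (k : ℕ) 1) = Pi.single j 1 := by
            funext l; rw [h1 l]; by_cases hl : l = j <;> simp [hl]
          rw [this, neighborSum_single_self]
        rw [h2, h1 j]
        exact .inr ⟨by simp, -e, by simp⟩

/-- The first two positions are exchanged so that vertices correspond; the third, bounded in both
words, changes its vertex, and its coordinate is reflected. -/
theorem conjugateWords_braid (pre post : List (ℤˣ × P)) (e : ℤˣ) {u v : P} (huv : G.Adj u v) :
    ConjugateWords G (pre ++ (e, u) :: (e, v) :: (e, u) :: post)
      (pre ++ (e, v) :: (e, u) :: (e, v) :: post) := by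
  refine ⟨by simp, fun m i i' hi hi' => ?_⟩
  have hm : pre.length + (post.length + 3) = m := by
    simpa using (congrArg List.length hi).symm
  let p : Fin m := ⟨pre.length, by omega⟩
  let q : Fin m := ⟨pre.length + 1, by omega⟩
  let b : Fin m := ⟨pre.length + 2, by omega⟩
  have hpb : p ≠ b := by simp [p, b]
  have hqb : q ≠ b := by simp [q, b]
  have hpq : p ≠ q := by simp [q, p]
  have hσb : Equiv.swap p q b = b := Equiv.swap_apply_of_ne_of_ne hpb.symm hqb.symm
  have hip : i p = (e, u) := by simpa [p] using (getElem?_of_ofFn_eq hi p).symm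
  have hiq : i q = (e, v) := by simpa [q] using (getElem?_of_ofFn_eq hi q).symm
  have hib : i b = (e, u) := by simpa [b] using (getElem?_of_ofFn_eq hi b).symm
  have hip' : i' p = (e, v) := by simpa [p] using (getElem?_of_ofFn_eq hi' p).symm
  have hiq' : i' q = (e, u) := by simpa [q] using (getElem?_of_ofFn_eq hi' q).symm
  have hib' : i' b = (e, v) := by simpa [b] using (getElem?_of_ofFn_eq hi' b).symm
  have hne (k : Fin m) (hk : (k : ℕ) < pre.length ∨ pre.length + 3 ≤ k) : i' k = i k := by
    have h1 := getElem?_of_ofFn_eq hi k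
    have h2 := getElem?_of_ofFn_eq hi' k
    rw [getElem?_append_cons_cons_cons pre post _ _ _ (e, v) (e, u) (e, v) hk, h2] at h1
    exact Option.some_injective _ h1
  -- Stated for arbitrary words of this shape, so that the converse follows by exchanging the roles
  -- of `i` and `i'`.
  have bounded {i i' : Fin m → ℤˣ × P} {u v : P} (huv : u ≠ v) (hip : i p = (e, u))
      (hiq : i q = (e, v)) (hib : i b = (e, u)) (hip' : i' p = (e, v)) (hiq' : i' q = (e, u))
      (hib' : i' b = (e, v))
      (hne : ∀ k : Fin m, (k : ℕ) < pre.length ∨ pre.length + 3 ≤ k → i' k = i k) (k : Fin m)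
      (hk : k ∈ boundedIndices i) : Equiv.swap p q k ∈ boundedIndices i' := by
    rw [mem_boundedIndices_iff] at hk ⊢
    obtain ⟨r, hr, hrk⟩ := hk
    by_cases hkb : k = b
    · rw [hkb, hσb, hib']
      exact ⟨p, by simp [p, b, Fin.lt_def], by rw [hip']⟩
    by_cases hkq : k = q
    · rw [hkq, Equiv.swap_apply_right, hip']
      rw [hkq, hiq] at hrk
      have hrp : r ≠ p := by rintro rfl; rw [hip] at hrk; exact huv hrk
      have hr' : (r : ℕ) < pre.length := by
        rw [hkq] at hr
        simp only [Fin.lt_def, ne_eq, Fin.ext_iff, p, q] at hr hrp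
        omega
      exact ⟨r, Fin.lt_def.mpr hr', by rw [hne r (.inl hr'), hrk]⟩
    by_cases hkp : k = p
    · rw [hkp, Equiv.swap_apply_left, hiq']
      rw [hkp] at hr hrk
      rw [hip] at hrk
      exact ⟨r, hr.trans (by simp [p, q, Fin.lt_def]), by rw [hne r (.inl hr), hrk]⟩
    rw [Equiv.swap_apply_of_ne_of_ne hkp hkq]
    have hk : (k : ℕ) < pre.length ∨ pre.length + 3 ≤ k := by
      simp only [Fin.ext_iff, p, q, b] at hkp hkq hkb
      omega
    rw [hne k hk, ← hrk]
    by_cases hr' : (r : ℕ) < pre.length ∨ pre.length + 3 ≤ r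
    · exact ⟨r, hr, by rw [hne r hr']⟩
    have hk' : pre.length + 3 ≤ k := by
      rw [Fin.lt_def] at hr
      omega
    -- A predecessor inside the block is replaced by a letter at the same vertex in the new word:
    -- `q` for `u`, `p` for `v`.
    obtain rfl | rfl | rfl : r = p ∨ r = q ∨ r = b := by
      simp only [Fin.ext_iff, p, q, b]
      omega
    · exact ⟨q, by simp only [Fin.lt_def, q]; omega, by rw [hip, hiq']⟩
    · exact ⟨p, by simp only [Fin.lt_def, p]; omega, by rw [hiq, hip']⟩
    · exact ⟨q, by simp only [Fin.lt_def, q]; omega, by rw [hib, hiq']⟩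
  have hfirst (k : Fin m) (hk : (k : ℕ) < pre.length + 3) :
      firstCoord post (pre.length + 3) (Pi.single (k : ℕ) 1) = 0 :=
    firstCoord_eq_zero post _ fun n hn => Pi.single_eq_of_ne (by omega) _
  have hf : coordAddFirst q post (pre.length + 3) v (Pi.single b 1) = 0 := by
    rw [coordAddFirst_apply, extendZero_single, hfirst b (by simp [b]), Pi.single_eq_of_ne hqb]
    rfl
  refine wordGroup_eq_map_conj_of_reflection G p q b _ hf hσb ?_ (fun k => ⟨fun hk => ?_, ?_⟩)
    (fun x y => ?_) fun k => ?_
  · exact mem_boundedIndices_iff.mpr ⟨p, by simp [p, b, Fin.lt_def], by rw [hip, hib]⟩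
  · have := bounded huv.ne' hip' hiq' hib' hip hiq hib (fun k hk => (hne k hk).symm) _ hk
    simpa using this
  · exact bounded huv.ne hip hiq hib hip' hiq' hib' hne k
  · have far (x : Fin m → ℤ) (n : ℕ) (hn : n < pre.length ∨ pre.length + 3 ≤ n) :
        extendZero (fun k => x (Equiv.swap p q k)) n = extendZero x n :=
      extendZero_congr fun hn' => congrArg x (Equiv.swap_apply_of_ne_of_ne
        (fun e => by have := congrArg Fin.val e; simp only [p] at this; omega)
        (fun e => by have := congrArg Fin.val e; simp only [q] at this; omega))
    have e0 (x : Fin m → ℤ) :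
        extendZero (coordReflection b _ hf fun k => x (Equiv.swap p q k)) pre.length =
          extendZero x (pre.length + 1) := by
      rw [extendZero_of_lt _ p.2, extendZero_of_lt _ q.2]
      exact (coordReflection_apply_of_ne b _ hf _ hpb).trans
        (congrArg x (Equiv.swap_apply_left p q))
    have e1 (x : Fin m → ℤ) :
        extendZero (coordReflection b _ hf fun k => x (Equiv.swap p q k)) (pre.length + 1) =
          extendZero x pre.length := by
      rw [extendZero_of_lt _ p.2, extendZero_of_lt _ q.2]
      exact (coordReflection_apply_of_ne b _ hf _ hqb).trans
        (congrArg x (Equiv.swap_apply_right p q))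
    have e2 (x : Fin m → ℤ) :
        extendZero (coordReflection b _ hf fun k => x (Equiv.swap p q k)) (pre.length + 2) =
          extendZero x pre.length + firstCoord post (pre.length + 3) (extendZero x) v
            - extendZero x (pre.length + 2) := by
      rw [extendZero_of_lt _ p.2, extendZero_of_lt _ b.2, extendZero_of_lt _ b.2]
      refine (coordReflection_apply_self b _ hf _).trans ?_
      rw [coordAddFirst_apply, firstCoord_congr post (pre.length + 3) fun n hn => far x n (.inr hn),
        Equiv.swap_apply_right, hσb]
    have e3 (x : Fin m → ℤ) (n : ℕ) (hn : n < pre.length ∨ pre.length + 3 ≤ n) :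
        extendZero (coordReflection b _ hf fun k => x (Equiv.swap p q k)) n = extendZero x n :=
      (extendZero_congr fun hn' => coordReflection_apply_of_ne b _ hf _
        fun e => by have := congrArg Fin.val e; simp only [b] at this; omega).trans (far x n hn)
    rw [hi, hi']
    exact wordForm_braid G pre post e huv (e0 x) (e1 x) (e2 x) (e3 x) (e0 y) (e1 y) (e2 y) (e3 y)
  -- The pairing is taken in the new word `v, u, v`, hence the symmetric adjacency. Its coefficient
  -- is `-2 e` at `q` and at the next letter at `v`, exactly where the functional equals `1`.
  · have hform := wordForm_single_of_braid G pre post e huv.symm (Pi.single (k : ℕ) 1)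
    simp only [hi', b]
    rw [hform, coordAddFirst_apply, extendZero_single]
    by_cases hk : k = q
    · subst hk
      rw [hfirst q (by simp [q])]
      refine .inr ⟨by simp, -e, by simp [q]⟩
    · have hk' : (k : ℕ) ≠ pre.length + 1 := fun e => hk (Fin.ext e)
      rw [Pi.single_eq_of_ne (Ne.symm hk), Pi.single_eq_of_ne hk'.symm, zero_add]
      by_cases h0 : firstCoord post (pre.length + 3) (Pi.single (k : ℕ) 1) v = 0
      · exact .inl h0
      · obtain ⟨h1, h2⟩ := firstCoord_single_eq_one h0
        rw [h2 u, h2 v, Pi.single_eq_of_ne (show pre.length ≠ (k : ℕ) by omega)]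
        exact .inr ⟨by simp, -e, by simp [huv.ne]⟩

theorem conjugateWords_isMoveInvariant : IsMoveInvariant G (ConjugateWords G) where
  toEquivalence := conjugateWords_equivalence G
  swap_sign pre post e i j := by
    by_cases hij : i = j
    · subst hij; exact conjugateWords_swap_sign G pre post e i
    · exact conjugateWords_swap_letters G pre post hij (.inl rfl)
  swap_comm pre post e i j hij h := conjugateWords_swap_letters G pre post hij (.inr h)
  braid pre post e i j h := conjugateWords_braid G pre post e h

end Moves

/-- For any two reduced words for the same pair `(u, v)` of elements of a simply-laced Coxeter
group, the attached groups are conjugate inside `GL (ℤ^m)`. -/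
theorem theorem3p4 {P : Type*} [Finite P] (G : SimpleGraph P) {W : Type*} [Group W]
    (cs : CoxeterSystem (simplyLaced G) W) (u v : W) {m : ℕ} (i i' : Fin m → ℤˣ × P)
    (hi : IsReducedWord cs u v i) (hi' : IsReducedWord cs u v i') :
    ∃ g : LinearMap.GeneralLinearGroup ℤ (Fin m → ℤ),
      wordGroup G i' = (wordGroup G i).map (MulAut.conj g).toMonoidHom := by
  have := Fintype.ofFinite P
  exact ((conjugateWords_isMoveInvariant G).of_isReducedWord cs hi hi').2 m i i' rfl rfl
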